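/- Let $\mathcal X$ be a finite set, $\mathcal H_B$ a finite-dimensional complex Hilbert space, $p_X$ a probability distribution on $\mathcal X$ and $\{\rho_B^x\}_{x\in\mathcal X}$ density operators on $\mathcal H_B$, and let $\rho_{XB}=\sum_{x}p_X(x)\,|x\rangle\langle x|\otimes\rho_B^x$. A POVM $\{\Pi_B^x\}_{x\in\mathcal X}$ on $\mathcal H_B$ (that is, $\Pi_B^x\ge 0$ and $\sum_x\Pi_B^x=\mathbf 1_B$) is written $\Pi_{XB}=\sum_x|x\rangle\langle x|\otimes\Pi_B^x$. For $\alpha\in[\tfrac12,\infty]\setminus\{1\}$ define the optimal expected $\alpha$-gain by $$\mathsf P_\alpha(X|B)_\rho=\sup_{\text{POVM }\Pi_{XB}}\operatorname{Tr}\!\big[\rho_{XB}\,\Pi_{XB}^{\frac{\alpha-1}{\alpha}}\big]\quad(\alpha>1),\qquad \mathsf P_\alpha(X|B)_\rho=\inf_{\text{POVM }\Pi_{XB}}\operatorname{Tr}\!\big[\rho_{XB}\,\Pi_{XB}^{\frac{\alpha-1}{\alpha}}\big]\quad(\alpha<1),$$ with $\frac{\alpha-1}{\alpha}=\frac{\alpha}{\alpha-1}=1$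 for $\alpha=\infty$. For $\alpha<1$ the power is taken on the support of $\Pi_{XB}$, and the trace is $+\infty$ unless $\operatorname{supp}\rho_{XB}\subseteq\operatorname{supp}\Pi_{XB}$. (So in all cases $\frac{\alpha}{\alpha-1}\log\mathsf P_\alpha(X|B)_\rho=\sup_{\Pi_{XB}}\frac{\alpha}{\alpha-1}\log\operatorname{Tr}[\rho_{XB}\Pi_{XB}^{(\alpha-1)/\alpha}]$.) For $\alpha=1$ define the minimal expected log-loss $\varepsilon_1(X|B)_\rho=\inf_{\text{POVM }\Pi_{XB}}-\operatorname{Tr}[\rho_{XB}\log\Pi_{XB}]$, where the logarithm is taken on the support of $\Pi_{XB}$ and the loss is $+\infty$ unless $\operatorname{supp}\rho_{XB}\subseteq\operatorname{supp}\Pi_{XB}$. For a density operator $\rho$ and $\sigma\ge0$, the measured Rényi divergence is $D_\alpha^{\mathbb M}(\rho\|\sigma)=\sup_{\{M_i\}}D_\alpha\big((\operatorname{Tr}[\rho M_i])_i\,\big\|\,(\operatorname{Tr}[\sigma M_i])_i\big)$, the supremum being over all POVMs with finitely many outcomes, where $D_\alpha(p\|q)=\frac1{\alpha-1}\log\sum_ip_i^\alpha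 q_i^{1-\alpha}$ for $\alpha\notin\{1,\infty\}$, $D_1(p\|q)=\sum_ip_i\log\frac{p_i}{q_i}$ and $D_\infty(p\|q)=\log\max_i\frac{p_i}{q_i}$, with the usual conventions (the value is $+\infty$ if $\alpha\ge1$ and $p\not\ll q$, or if $\alpha<1$ and $p\perp q$; terms with $p_i=0$ are disregarded). The measured conditional Rényi entropy is $$H_\alpha^{\mathbb M}(X|B)_\rho=-\inf_{\sigma_B}D_\alpha^{\mathbb M}(\rho_{XB}\,\|\,\mathbf 1_X\otimes\sigma_B),$$ the infimum being over all density operators $\sigma_B$ on $\mathcal H_B$. **Theorem.** For every $\alpha\in[\tfrac12,\infty]\setminus\{1\}$, $$\frac{\alpha}{\alpha-1}\log\mathsf P_\alpha(X|B)_\rho=-H_\alpha^{\mathbb M}(X|B)_\rho,$$ and for $\alpha=1$, $$-\varepsilon_1(X|B)_\rho=-H_1^{\mathbb M}(X|B)_\rho.$$ -/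

import Mathlib

open scoped ENNReal Kronecker ComplexOrder

noncomputable section

namespace AlphaGain

/-! Finite-dimensional systems are coordinatised: operators on `H_B = ℂ^B` are matrices
`Matrix B B ℂ`, operators on `H_X ⊗ H_B` are matrices indexed by `X × B`. Extended quantities
take values in `EReal`, `log` is the natural logarithm (`ENNReal.log` satisfies
`log 0 = ⊥`, `log ⊤ = ⊤`). -/

/-- A density matrix (quantum state): positive semidefinite with unit trace. -/
def IsDensity {d : Type*} [Fintype d] (ρ : Matrix d d ℂ) : Prop :=
  ρ.PosSemidef ∧ ρ.trace = 1

/-- A POVM with outcome set `ι`. -/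
def IsPOVM {ι d : Type*} [Fintype ι] [DecidableEq d] (M : ι → Matrix d d ℂ) : Prop :=
  (∀ i, (M i).PosSemidef) ∧ ∑ i, M i = 1

/-- A probability distribution on a finite set. -/
def IsProb {X : Type*} [Fintype X] (p : X → ℝ) : Prop :=
  (∀ x, 0 ≤ p x) ∧ ∑ x, p x = 1

/-- The classical-quantum operator `∑ₓ |x⟩⟨x| ⊗ A x`. For a POVM `A` this is `E_XB`. -/
def cqOp {X B : Type*} [Fintype X] [DecidableEq X] (A : X → Matrix B B ℂ) :
    Matrix (X × B) (X × B) ℂ :=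
  ∑ x, Matrix.single x x (1 : ℂ) ⊗ₖ A x

/-- The classical-quantum state `ρ_XB = ∑ₓ p x |x⟩⟨x| ⊗ ρ x`. -/
def cqState {X B : Type*} [Fintype X] [DecidableEq X] (p : X → ℝ) (ρ : X → Matrix B B ℂ) :
    Matrix (X × B) (X × B) ℂ :=
  cqOp fun x => (p x : ℂ) • ρ x

/-- The support of a positive semidefinite matrix, i.e. its range. -/
def supp {d : Type*} [Fintype d] (A : Matrix d d ℂ) : Submodule ℂ (d → ℂ) :=
  LinearMap.range A.mulVecLin

/-- The Rényi divergence of order `α ∈ (0, ∞]` of a probability vector `p` relative to a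
nonnegative vector `q`, both on a finite set. For `α ∉ {1, ∞}` it is
`(α - 1)⁻¹ log ∑ᵢ pᵢ ^ α qᵢ ^ (1 - α)`, where the arithmetic of `ℝ≥0∞` gives the usual
conventions: for `α > 1` the value is `+∞` unless `p ≪ q`, with vanishing summands where
`pᵢ = 0`; for `α < 1` the value is `+∞` exactly if `p ⟂ q`. -/
def renyiDiv {ι : Type*} [Fintype ι] (α : ℝ≥0∞) (p q : ι → ℝ) : EReal :=
  open scoped Classical in
  if α = ⊤ then
    ENNReal.log (⨆ i, ENNReal.ofReal (p i) / ENNReal.ofReal (q i))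
  else if α = 1 then
    if ∀ i, q i = 0 → p i = 0 then ((∑ i, p i * Real.log (p i / q i) : ℝ) : EReal) else ⊤
  else
    (((α.toReal - 1)⁻¹ : ℝ) : EReal) *
      ENNReal.log
        (∑ i, ENNReal.ofReal (p i) ^ α.toReal * ENNReal.ofReal (q i) ^ (1 - α.toReal))

/-- The measured Rényi divergence: the supremum of the classical Rényi divergences of the
outcome statistics over all POVMs with finitely many outcomes. -/
def measuredRenyiDiv {d : Type*} [Fintype d] [DecidableEq d] (α : ℝ≥0∞)
    (ρ σ : Matrix d d ℂ) : EReal :=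
  ⨆ (n : ℕ) (M : Fin n → Matrix d d ℂ) (_ : IsPOVM M),
    renyiDiv α (fun i => (ρ * M i).trace.re) (fun i => (σ * M i).trace.re)

/-- The measured conditional Rényi entropy
`H_α(X|B)_ρ = - inf_σ D_α(ρ_XB ‖ 1_X ⊗ σ_B)`, with `σ_B` ranging over all states on `B`. -/
def measuredCondEntropy {X B : Type*} [Fintype X] [DecidableEq X] [Fintype B] [DecidableEq B]
    (α : ℝ≥0∞) (ρ : Matrix (X × B) (X × B) ℂ) : EReal :=
  -⨅ (σ : Matrix B B ℂ) (_ : IsDensity σ),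
    measuredRenyiDiv α ρ ((1 : Matrix X X ℂ) ⊗ₖ σ)

/-- The exponent `(α - 1) / α`, equal to `1` at `α = ∞`. -/
def gainExponent (α : ℝ≥0∞) : ℝ :=
  if α = ⊤ then 1 else (α.toReal - 1) / α.toReal

/-- The prefactor `α / (α - 1)`, equal to `1` at `α = ∞`. -/
def gainFactor (α : ℝ≥0∞) : ℝ :=
  if α = ⊤ then 1 else α.toReal / (α.toReal - 1)

/-- The expected `α`-gain `Tr[ρ E ^ ((α - 1) / α)]` of `E` under `ρ`. The power is taken
by functional calculus. If `α < 1` the exponent is negative: then the gain is `+∞`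
unless `supp ρ ⊆ supp E`, and in that case the power is taken on the support of `E`. -/
def expectedGain {d : Type*} [Fintype d] [DecidableEq d] (α : ℝ≥0∞)
    (ρ E : Matrix d d ℂ) : ℝ≥0∞ :=
  open scoped Classical in
  if α < 1 ∧ ¬ supp ρ ≤ supp E then ⊤
  else ENNReal.ofReal (ρ * cfc (fun t : ℝ => t ^ gainExponent α) E).trace.re

/-- The optimal expected `α`-gain `P_α(X|B)_ρ` over all POVMs `E_XB = ∑ₓ |x⟩⟨x| ⊗ E x` on `B`
with outcomes in `X`: the maximal one for `α > 1`. For `α < 1` the factor `α / (α - 1)` is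
negative, so that the best gain (least loss) is the infimum. -/
def optimalGain {X B : Type*} [Fintype X] [DecidableEq X] [Fintype B] [DecidableEq B]
    (α : ℝ≥0∞) (ρ : Matrix (X × B) (X × B) ℂ) : ℝ≥0∞ :=
  open scoped Classical in
  if α < 1 then
    ⨅ (E : X → Matrix B B ℂ) (_ : IsPOVM E), expectedGain α ρ (cqOp E)
  else
    ⨆ (E : X → Matrix B B ℂ) (_ : IsPOVM E), expectedGain α ρ (cqOp E)

/-- The expected log-loss `-Tr[ρ log E]` of `E` under `ρ`, equal to `+∞` unless
`supp ρ ⊆ supp E` (the logarithm is taken on the support of `E`). -/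
def expectedLogLoss {d : Type*} [Fintype d] [DecidableEq d] (ρ E : Matrix d d ℂ) : EReal :=
  open scoped Classical in
  if supp ρ ≤ supp E then ((-(ρ * cfc Real.log E).trace.re : ℝ) : EReal) else ⊤

/-- The minimal expected log-loss `ε₁(X|B)_ρ` over all POVMs on `B` with outcomes in `X`. -/
def minLogLoss {X B : Type*} [Fintype X] [DecidableEq X] [Fintype B] [DecidableEq B]
    (ρ : Matrix (X × B) (X × B) ℂ) : EReal :=
  ⨅ (E : X → Matrix B B ℂ) (_ : IsPOVM E), expectedLogLoss ρ (cqOp E)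

end AlphaGain

end

namespace AlphaGain

open MeasureTheory Set Filter Topology

/-! Put s = (α-1)/α and let ln_s be the deformed logarithm, with ln_0 = log. By Hölder's inequality,
D_α(p‖q) is the supremum of α/(α-1) log ∑ pᵢ wᵢ^s over weights w with ∑ qᵢ wᵢ = 1 (of ∑ pᵢ log wᵢ if
α = 1). The condition α ≥ 1/2 means s ∈ [-1, 1], where ln_s is operator monotone and operator
concave.

Gain ≤ divergence: given a POVM E, measure the spectral projections of E_XB and use its eigenvalues
as weights. They are normalised for every σ, because Tr[(1 ⊗ σ) E_XB] = Tr σ = 1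
(`gainFactor_mul_log_expectedGain_le`).

Divergence ≤ gain: a single σ must serve all measurements. Let F bound Tr[ρ ln_s E_XB] over positive
definite E_XB. For one weighted POVM (M, w) with Z = ∑ wᵢ Mᵢ, let t be the largest eigenvalue of the
sum of the diagonal blocks of Z. Dividing these blocks by t and adding the missing mass to one of
them gives a POVM E, and the operator Jensen inequality bounds ∑ pᵢ ln_s(wᵢ/t) by F. A state σ
attaining t then satisfies ∑ pᵢ ln_s wᵢ ≤ F + (1 + sF)(Tr[(1 ⊗ σ) Z] - 1). This inequality is affine
in σ and in the pair (Z, ∑ pᵢ ln_s wᵢ), and such pairs form a convex set, so Sion's minimax theorem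
yields one σ for all weighted POVMs (`exists_isDensity_forall_sum_mul_deformedLog_le`). Optimising
over w recovers D_α. -/

/-- The deformed logarithm `(t ^ s - 1) / s`, which is `log t` at `s = 0`. -/
noncomputable def deformedLog (s t : ℝ) : ℝ :=
  if s = 0 then Real.log t else (t ^ s - 1) / s

theorem deformedLog_zero (t : ℝ) : deformedLog 0 t = Real.log t := if_pos rfl

theorem deformedLog_of_ne {s : ℝ} (hs : s ≠ 0) (t : ℝ) :
    deformedLog s t = (t ^ s - 1) / s := if_neg hs

theorem one_add_mul_deformedLog {s : ℝ} (hs : s ≠ 0) (t : ℝ) :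
    1 + s * deformedLog s t = t ^ s := by
  rw [deformedLog_of_ne hs]; field_simp; ring

/-! ### From resolvent inequalities to deformed logarithms -/

section ResolventOrder

variable {ι κ : Type*} [Fintype ι] [Fintype κ] {m w : ι → ℝ} {n l : κ → ℝ}

theorem integrable_sum_mul {Ω τ : Type*} [MeasurableSpace Ω] [Fintype τ] {μ : Measure Ω}
    {φ : ℝ → ℝ} {k : Ω → ℝ → ℝ}
    (hφ : ∀ x, 0 < x → Integrable (fun t => k t x) μ ∧ φ x = ∫ t, k t x ∂μ)
    (a : τ → ℝ) {x : τ → ℝ} (hx : ∀ i, 0 < x i) :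
    Integrable (fun t => ∑ i, a i * k t (x i)) μ ∧
      ∑ i, a i * φ (x i) = ∫ t, ∑ i, a i * k t (x i) ∂μ := by
  have h : ∀ i ∈ Finset.univ, Integrable (fun t => a i * k t (x i)) μ :=
    fun i _ => (hφ _ (hx i)).1.const_mul _
  refine ⟨integrable_finsetSum _ h, ?_⟩
  rw [integral_finsetSum _ h]
  simp_rw [integral_const_mul, (hφ _ (hx _)).2]

theorem sum_mul_le_sum_mul_of_integral {Ω : Type*} [MeasurableSpace Ω] {μ : Measure Ω}
    {φ : ℝ → ℝ} {k : Ω → ℝ → ℝ}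
    (hφ : ∀ x, 0 < x → Integrable (fun t => k t x) μ ∧ φ x = ∫ t, k t x ∂μ)
    (hw : ∀ i, 0 < w i) (hl : ∀ j, 0 < l j)
    (hk : ∀ᵐ t ∂μ, ∑ i, m i * k t (w i) ≤ ∑ j, n j * k t (l j)) :
    ∑ i, m i * φ (w i) ≤ ∑ j, n j * φ (l j) := by
  rw [(integrable_sum_mul hφ m hw).2, (integrable_sum_mul hφ n hl).2]
  exact integral_mono_ae (integrable_sum_mul hφ m hw).1 (integrable_sum_mul hφ n hl).1 hk

theorem sum_mul_rpowIntegrand {τ : Type*} [Fintype τ] (s t : ℝ) (a x : τ → ℝ) :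
    ∑ i, a i * Real.rpowIntegrand₀₁ s t (x i)
      = t ^ s * (t⁻¹ * ∑ i, a i - ∑ i, a i * (t + x i)⁻¹) := by
  rw [Finset.mul_sum, ← Finset.sum_sub_distrib, Finset.mul_sum]
  exact Finset.sum_congr rfl fun i _ => by rw [Real.rpowIntegrand₀₁]; ring

/-- The power x^s is an integral of t^s (1/t - 1/(t+x)) over t > 0. Equal total masses cancel the
1/t terms, and the resolvent inequality enters with a minus sign. -/
theorem sum_mul_rpow_le (hw : ∀ i, 0 < w i) (hl : ∀ j, 0 < l j)
    (h1 : ∑ i, m i = ∑ j, n j)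
    (h3 : ∀ u, 0 ≤ u → ∑ j, n j * (u + l j)⁻¹ ≤ ∑ i, m i * (u + w i)⁻¹)
    {s : ℝ} (hs : s ∈ Ioo (0 : ℝ) 1) :
    ∑ i, m i * w i ^ s ≤ ∑ j, n j * l j ^ s := by
  obtain ⟨μ, hμ⟩ := Real.exists_measure_rpow_eq_integral_rpowIntegrand₀₁ hs
  refine sum_mul_le_sum_mul_of_integral (μ := μ.restrict (Ioi 0))
    (fun x hx => hμ x hx.le) hw hl ?_
  refine (ae_restrict_mem measurableSet_Ioi).mono fun t (ht : 0 < t) => ?_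
  rw [sum_mul_rpowIntegrand, sum_mul_rpowIntegrand, h1]
  have := h3 t ht.le
  gcongr

theorem sum_mul_rpow_neg_le (hw : ∀ i, 0 < w i) (hl : ∀ j, 0 < l j)
    (h3 : ∀ u, 0 ≤ u → ∑ j, n j * (u + l j)⁻¹ ≤ ∑ i, m i * (u + w i)⁻¹)
    {s : ℝ} (hs : s ∈ Ioo (-1 : ℝ) 0) :
    ∑ j, n j * l j ^ s ≤ ∑ i, m i * w i ^ s := by
  -- Since x^s = x^(s+1) / x, dividing the kernel of order s+1 by x leaves t^s / (t+x), a pure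
  -- resolvent.
  obtain ⟨μ, hμ⟩ := Real.exists_measure_rpow_eq_integral_rpowIntegrand₀₁
    (p := s + 1) ⟨by linarith [hs.1], by linarith [hs.2]⟩
  refine sum_mul_le_sum_mul_of_integral (μ := μ.restrict (Ioi 0))
    (φ := fun x => x ^ s) (k := fun t x => Real.rpowIntegrand₀₁ (s + 1) t x * x⁻¹)
    (fun x hx => ⟨(hμ x hx.le).1.mul_const _, ?_⟩) hl hw ?_
  · rw [integral_mul_const, ← (hμ x hx.le).2, Real.rpow_add_one hx.ne',
      mul_inv_cancel_right₀ hx.ne']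
  refine (ae_restrict_mem measurableSet_Ioi).mono fun t (ht : 0 < t) => ?_
  have hker : ∀ x : ℝ, 0 < x → Real.rpowIntegrand₀₁ (s + 1) t x * x⁻¹ = t ^ s * (t + x)⁻¹ := by
    intro x hx
    rw [Real.rpowIntegrand₀₁, Real.rpow_add_one ht.ne']
    have : t + x ≠ 0 := by positivity
    field_simp; ring
  simp_rw [hker _ (hl _), hker _ (hw _), mul_left_comm _ (t ^ s), ← Finset.mul_sum]
  have := h3 t ht.le
  gcongr

/-- An inequality between the resolvents of two weighted families, together with the one
between their means, implies the inequality for every deformed logarithm of order in `[-1, 1]`. -/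
theorem sum_mul_deformedLog_le (hw : ∀ i, 0 < w i) (hl : ∀ j, 0 < l j)
    (h1 : ∑ i, m i = ∑ j, n j) (h2 : ∑ i, m i * w i ≤ ∑ j, n j * l j)
    (h3 : ∀ u, 0 ≤ u → ∑ j, n j * (u + l j)⁻¹ ≤ ∑ i, m i * (u + w i)⁻¹)
    {s : ℝ} (hs : -1 ≤ s) (hs' : s ≤ 1) :
    ∑ i, m i * deformedLog s (w i) ≤ ∑ j, n j * deformedLog s (l j) := by
  have red : ∀ {r : ℝ}, r ≠ 0 →
      0 ≤ (∑ j, n j * l j ^ r - ∑ i, m i * w i ^ r) / r →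
      ∑ i, m i * deformedLog r (w i) ≤ ∑ j, n j * deformedLog r (l j) := by
    intro r hr h
    rw [← sub_nonneg]
    refine h.trans_eq ?_
    simp_rw [deformedLog_of_ne hr, mul_div_assoc', ← Finset.sum_div, mul_sub, mul_one,
      Finset.sum_sub_distrib, h1]
    ring
  have pos : ∀ r ∈ Ioo (0 : ℝ) 1,
      ∑ i, m i * deformedLog r (w i) ≤ ∑ j, n j * deformedLog r (l j) := fun r hr =>
    red hr.1.ne' (div_nonneg (sub_nonneg.2 (sum_mul_rpow_le hw hl h1 h3 hr)) hr.1.le)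
  -- The integrals miss three orders: -1 is the resolvent inequality at u = 0, 1 is the inequality
  -- of the means, and 0 is the limit of positive orders.
  rcases hs.eq_or_lt with rfl | hs
  · refine red (by norm_num) (div_nonneg_of_nonpos ?_ (by norm_num))
    simpa [Real.rpow_neg_one] using h3 0 le_rfl
  rcases hs'.eq_or_lt with rfl | hs'
  · exact red one_ne_zero (by simpa using h2)
  rcases lt_trichotomy s 0 with h | rfl | h
  · exact red h.ne (div_nonneg_of_nonpos
      (sub_nonpos.2 (sum_mul_rpow_neg_le hw hl h3 ⟨hs, h⟩)) h.le)
  · have lim : ∀ x : ℝ, 0 < x →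
        Tendsto (fun r => deformedLog r x) (𝓝[>] 0) (𝓝 (deformedLog 0 x)) := by
      intro x hx
      rw [deformedLog_zero]
      refine (tendsto_rpow_sub_one_log hx).congr' ?_
      filter_upwards [self_mem_nhdsWithin] with r hr
      rw [deformedLog_of_ne (ne_of_gt hr), div_eq_inv_mul]
    refine le_of_tendsto_of_tendsto
      (tendsto_finsetSum _ fun i _ => (lim _ (hw i)).const_mul (m i))
      (tendsto_finsetSum _ fun j _ => (lim _ (hl j)).const_mul (n j)) ?_
    filter_upwards [Ioo_mem_nhdsGT (zero_lt_one' ℝ)] with r hr using pos r hr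
  · exact pos s ⟨h, hs'⟩

end ResolventOrder

/-- A function on `K × C` that is affine in either variable and continuous, with `K` compact:
if every `c ∈ C` has a response in `K` with nonpositive value, then one element of `K` is a
response to all of `C`. -/
theorem exists_forall_nonpos_of_forall_exists {V W : Type*}
    [AddCommGroup V] [Module ℝ V] [TopologicalSpace V] [IsTopologicalAddGroup V]
    [ContinuousSMul ℝ V] [AddCommGroup W] [Module ℝ W] [TopologicalSpace W]
    [IsTopologicalAddGroup W] [ContinuousSMul ℝ W]
    {K : Set V} {C : Set W} (hne : K.Nonempty) (hK : IsCompact K) (hKc : Convex ℝ K)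
    (hC : Convex ℝ C) {f : V → W → ℝ}
    (hf₁ : ∀ c, Continuous fun v => f v c) (hf₂ : ∀ v, Continuous (f v))
    (hf₁' : ∀ c, ConvexOn ℝ K fun v => f v c) (hf₂' : ∀ v, ConcaveOn ℝ C (f v))
    (h : ∀ c ∈ C, ∃ v ∈ K, f v c ≤ 0) : ∃ v ∈ K, ∀ c ∈ C, f v c ≤ 0 := by
  by_contra! hcon
  -- If no response works, the open sets where f(·, c) > 0 cover K. Compactness leaves finitely many
  -- c, and Sion's theorem merges them into one c that is positive on all of K.
  obtain ⟨s, hsC, hs, hcov⟩ := hK.elim_finite_subcover_image (b := C)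
    (c := fun c => {v | 0 < f v c}) (fun c _ => isOpen_lt continuous_const (hf₁ c))
    (fun v hv => by simpa using hcon v hv)
  obtain ⟨c, hc, hpos⟩ := Sion.exists_lt_iInf_of_lt_iInf_of_finite (X := K) (Y := C) (f := f)
    (t := 0) hne hK (fun c _ => (hf₁ c).lowerSemicontinuous.lowerSemicontinuousOn _)
    (fun c _ => (hf₁' c).quasiconvexOn) hC
    (fun v _ => (hf₂ v).upperSemicontinuous.upperSemicontinuousOn _)
    (fun v _ => (hf₂' v).quasiconcaveOn) hKc hs hsC
    (fun v hv => by simpa using hcov hv)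
  obtain ⟨v, hv, hle⟩ := h c hc
  exact (hpos v hv).not_ge hle

open scoped MatrixOrder in
theorem exists_eq_conjTranspose_mul_self {d : Type*} [Fintype d] {A : Matrix d d ℂ}
    (hA : A.PosSemidef) : ∃ C : Matrix d d ℂ, A = C.conjTranspose * C := by
  classical
  exact CStarAlgebra.nonneg_iff_eq_star_mul_self.1 hA.nonneg

/-! ### The compact convex set of states -/

section Density
variable {B : Type*} [Fintype B]

/-- States are the image of the Hilbert–Schmidt unit sphere under A ↦ A* A, and this sphere is
closed with entries in the unit disc. -/
theorem isCompact_setOf_isDensity : IsCompact {σ : Matrix B B ℂ | IsDensity σ} := by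
  classical
  have hS : IsCompact {A : Matrix B B ℂ | (A.conjTranspose * A).trace = 1} := by
    refine IsCompact.of_isClosed_subset
      (isCompact_univ_pi fun _ : B => isCompact_univ_pi fun _ : B =>
        isCompact_closedBall (0 : ℂ) 1)
      (isClosed_eq (by fun_prop) continuous_const) ?_
    intro A hA i _ j _
    have h : ∑ j, ∑ i, ‖A i j‖ ^ 2 = 1 := by
      have := congrArg Complex.re (hA : (A.conjTranspose * A).trace = 1)
      simpa [Matrix.trace, Matrix.mul_apply, ← Complex.normSq_eq_conj_mul_self,
        Complex.normSq_eq_norm_sq, ← Complex.ofReal_pow] using this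
    have h1 : ‖A i j‖ ^ 2 ≤ 1 := by
      rw [← h]
      refine (Finset.single_le_sum (f := fun i => ‖A i j‖ ^ 2) (fun _ _ => by positivity)
        (Finset.mem_univ i)).trans ?_
      exact Finset.single_le_sum (f := fun j => ∑ i, ‖A i j‖ ^ 2) (fun _ _ => by positivity)
        (Finset.mem_univ j)
    simpa using (sq_le_one_iff₀ (norm_nonneg _)).1 h1
  convert hS.image (f := fun A : Matrix B B ℂ => A.conjTranspose * A) (by fun_prop) using 1
  ext σ
  simp only [mem_ofPred_eq, IsDensity, mem_image]
  constructor
  · rintro ⟨h, ht⟩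
    obtain ⟨A, rfl⟩ := exists_eq_conjTranspose_mul_self h
    exact ⟨A, ht, rfl⟩
  · rintro ⟨A, hA, rfl⟩
    exact ⟨Matrix.posSemidef_conjTranspose_mul_self A, hA⟩

theorem convex_setOf_isDensity : Convex ℝ {σ : Matrix B B ℂ | IsDensity σ} := by
  rintro σ ⟨h1, h2⟩ τ ⟨h3, h4⟩ a b ha hb hab
  refine ⟨(h1.smul ha).add (h3.smul hb), ?_⟩
  rw [Matrix.trace_add, Matrix.trace_smul, Matrix.trace_smul, h2, h4, ← add_smul, hab, one_smul]

theorem isDensity_inv_trace_smul {A : Matrix B B ℂ} (hA : A.PosSemidef) (h0 : A ≠ 0) :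
    IsDensity (A.trace⁻¹ • A) := by
  have ht : A.trace ≠ 0 := fun h => h0 (hA.trace_eq_zero_iff.1 h)
  exact ⟨hA.smul (inv_nonneg.2 hA.trace_nonneg),
    by rw [Matrix.trace_smul, smul_eq_mul, inv_mul_cancel₀ ht]⟩

theorem exists_isDensity [Nonempty B] : ∃ σ : Matrix B B ℂ, IsDensity σ := by
  classical
  exact ⟨_, isDensity_inv_trace_smul Matrix.PosSemidef.one one_ne_zero⟩

/-- The largest expectation value of a Hermitian matrix over all states bounds it. -/
theorem exists_isDensity_posSemidef_sub [Nonempty B] [DecidableEq B] {H : Matrix B B ℂ}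
    (hH : H.IsHermitian) :
    ∃ σ, IsDensity σ ∧ ((σ * H).trace.re • (1 : Matrix B B ℂ) - H).PosSemidef := by
  obtain ⟨σ, hσ, hmax⟩ := (isCompact_setOf_isDensity (B := B)).exists_isMaxOn exists_isDensity
    (f := fun σ => (σ * H).trace.re) (by fun_prop)
  refine ⟨σ, hσ, Matrix.PosSemidef.of_dotProduct_mulVec_nonneg ?_ fun v => ?_⟩
  · exact (Matrix.isHermitian_one.smul (IsSelfAdjoint.all _)).sub hH
  rcases eq_or_ne v 0 with rfl | hv
  · simp
  -- Testing maximality against the pure state along v gives nonnegativity of the quadratic form at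
  -- v.
  set A := Matrix.vecMulVec v (star v)
  have hA : A.PosSemidef := Matrix.posSemidef_vecMulVec_self_star v
  have hA0 : A ≠ 0 := by simpa [A, Matrix.vecMulVec_eq_zero] using hv
  have h1 : ((A.trace⁻¹ • A) * H).trace.re ≤ (σ * H).trace.re :=
    hmax (isDensity_inv_trace_smul hA hA0)
  set t := (σ * H).trace.re
  have h2 : A.trace = star v ⬝ᵥ v := by
    rw [Matrix.trace_vecMulVec, dotProduct_comm]
  have h3 : (A * H).trace = star v ⬝ᵥ H.mulVec v := by
    rw [Matrix.trace_mul_comm, Matrix.mul_vecMulVec, Matrix.trace_vecMulVec, dotProduct_comm]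
  have h4 : 0 < star v ⬝ᵥ v := by simpa using hv
  obtain ⟨r, hr, hr'⟩ : ∃ r : ℝ, 0 < r ∧ star v ⬝ᵥ v = r :=
    ⟨(star v ⬝ᵥ v).re, (Complex.lt_def.1 h4).1, Complex.ext rfl (Complex.lt_def.1 h4).2.symm⟩
  rw [Matrix.smul_mul, Matrix.trace_smul, h2, h3, hr', smul_eq_mul, ← Complex.ofReal_inv,
    Complex.re_ofReal_mul, inv_mul_le_iff₀ hr] at h1
  have h5 : (star v ⬝ᵥ H.mulVec v).im = 0 := hH.im_star_dotProduct_mulVec_self v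
  rw [Matrix.sub_mulVec, Matrix.smul_mulVec, Matrix.one_mulVec, dotProduct_sub,
    dotProduct_smul, hr', Complex.le_def]
  simp [h5]
  linarith

end Density


theorem trace_mul_re_nonneg {d : Type*} [Fintype d] {A C : Matrix d d ℂ}
    (hA : A.PosSemidef) (hC : C.PosSemidef) :
    0 ≤ (A * C).trace.re := by
  obtain ⟨D, rfl⟩ := exists_eq_conjTranspose_mul_self hC
  rw [← mul_assoc, Matrix.trace_mul_comm, ← mul_assoc]
  exact (Complex.le_def.1 (hA.mul_mul_conjTranspose_same D).trace_nonneg).1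

/-! ### Spectral measurements and operator Jensen -/

section Spectral
variable {d : Type*} [Fintype d] [DecidableEq d]

/-- The rank-one spectral projections of a Hermitian matrix. -/
noncomputable def spectralProj {Ω : Matrix d d ℂ} (hΩ : Ω.IsHermitian) (j : d) : Matrix d d ℂ :=
  Unitary.conjStarAlgAut ℂ _ hΩ.eigenvectorUnitary (Matrix.diagonal (Pi.single j 1))

variable {Ω : Matrix d d ℂ} (hΩ : Ω.IsHermitian)

theorem posSemidef_spectralProj (j : d) : (spectralProj hΩ j).PosSemidef := by
  rw [spectralProj, Unitary.conjStarAlgAut_apply]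
  refine Matrix.PosSemidef.mul_mul_conjTranspose_same (Matrix.PosSemidef.diagonal ?_) _
  intro i
  rcases eq_or_ne i j with rfl | h <;> simp [*]

theorem cfc_eq_sum_spectralProj (f : ℝ → ℝ) :
    cfc f Ω = ∑ j, f (hΩ.eigenvalues j) • spectralProj hΩ j := by
  have : (Matrix.diagonal (RCLike.ofReal ∘ f ∘ hΩ.eigenvalues) : Matrix d d ℂ)
      = ∑ j, (f (hΩ.eigenvalues j) : ℂ) • Matrix.diagonal (Pi.single j 1) := by
    ext a b
    simp only [Matrix.sum_apply, Matrix.smul_apply, Matrix.diagonal_apply, Pi.single_apply]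
    by_cases h : a = b <;> simp [h]
  rw [hΩ.cfc_eq, Matrix.IsHermitian.cfc, this, map_sum]
  simp_rw [map_smul]
  rfl

theorem isPOVM_spectralProj : IsPOVM (spectralProj hΩ) := by
  refine ⟨posSemidef_spectralProj hΩ, ?_⟩
  have h := cfc_eq_sum_spectralProj hΩ (fun _ => 1)
  simp only [one_smul] at h
  rw [← h, cfc_const_one ℝ Ω hΩ.isSelfAdjoint]

theorem sum_eigenvalues_smul_spectralProj :
    ∑ j, hΩ.eigenvalues j • spectralProj hΩ j = Ω := by
  rw [← cfc_eq_sum_spectralProj hΩ (fun t => t), cfc_id' ℝ Ω hΩ.isSelfAdjoint]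

theorem re_trace_mul_sum_smul {ι : Type*} [Fintype ι] (ρ : Matrix d d ℂ) (c : ι → ℝ)
    (M : ι → Matrix d d ℂ) :
    (ρ * ∑ i, c i • M i).trace.re = ∑ i, (ρ * M i).trace.re * c i := by
  simp [Finset.mul_sum, Matrix.trace_sum, mul_comm]

theorem re_trace_mul_cfc (ρ : Matrix d d ℂ) (f : ℝ → ℝ) :
    (ρ * cfc f Ω).trace.re
      = ∑ j, (ρ * spectralProj hΩ j).trace.re * f (hΩ.eigenvalues j) := by
  rw [cfc_eq_sum_spectralProj hΩ, re_trace_mul_sum_smul]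

theorem sum_re_trace_mul_of_isPOVM {ι : Type*} [Fintype ι] {M : ι → Matrix d d ℂ}
    (hM : IsPOVM M) (ρ : Matrix d d ℂ) : ∑ i, (ρ * M i).trace.re = ρ.trace.re := by
  have := re_trace_mul_sum_smul ρ (fun _ => 1) M
  simpa [hM.2] using this.symm

/-- Operator convexity of the inverse, in the form of Jensen's inequality for a POVM. -/
theorem posSemidef_sum_inv_smul_sub {ι : Type*} [Fintype ι] {M : ι → Matrix d d ℂ}
    (hM : IsPOVM M) {w : ι → ℝ} (hw : ∀ i, 0 < w i) {Ω R : Matrix d d ℂ}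
    (hΩ : (Ω - ∑ i, w i • M i).PosSemidef) (hR : R.IsHermitian) (hRΩ : R * Ω = 1) :
    (∑ i, (w i)⁻¹ • M i - R).PosSemidef := by
  -- Completing the square, with R the inverse of Ω: both terms on the right are visibly positive.
  have key : ∑ i, (w i)⁻¹ • M i - R
      = ∑ i, w i • (((w i)⁻¹ • 1 - R) * M i * ((w i)⁻¹ • 1 - R).conjTranspose)
        + R * (Ω - ∑ i, w i • M i) * R.conjTranspose := by
    have e : ∀ i, w i • (((w i)⁻¹ • 1 - R) * M i * ((w i)⁻¹ • 1 - R).conjTranspose)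
        = (w i)⁻¹ • M i - M i * R - R * M i + R * (w i • M i) * R := by
      intro i
      have h := (hw i).ne'
      rw [Matrix.conjTranspose_sub, hR.eq]
      simp only [Matrix.conjTranspose_smul, Matrix.conjTranspose_one, star_trivial, sub_mul,
        mul_sub, smul_sub, Matrix.smul_mul, Matrix.mul_smul, one_mul, mul_one, smul_smul,
        mul_inv_cancel₀ h, one_smul, mul_inv_cancel_left₀ h]
      abel
    simp_rw [e]
    rw [Finset.sum_add_distrib, Finset.sum_sub_distrib, Finset.sum_sub_distrib,
      ← Finset.sum_mul, ← Finset.mul_sum, hM.2, ← Finset.sum_mul, ← Finset.mul_sum, hR.eq,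
      mul_sub, hRΩ, sub_mul, one_mul, mul_one]
    abel
  rw [key]
  exact (Matrix.posSemidef_sum _ fun i _ =>
    ((hM.1 i).mul_mul_conjTranspose_same _).smul (hw i).le).add
      (hΩ.mul_mul_conjTranspose_same _)

/-- **Operator Jensen inequality** for the deformed logarithms: they are operator monotone
and operator concave. -/
theorem sum_mul_deformedLog_le_re_trace_mul_cfc {ι : Type*} [Fintype ι]
    {M : ι → Matrix d d ℂ} (hM : IsPOVM M) {w : ι → ℝ} (hw : ∀ i, 0 < w i)
    {Ω ρ : Matrix d d ℂ} (hΩ : Ω.PosDef) (hle : (Ω - ∑ i, w i • M i).PosSemidef)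
    (hρ : ρ.PosSemidef) {s : ℝ} (hs : -1 ≤ s) (hs' : s ≤ 1) :
    ∑ i, (ρ * M i).trace.re * deformedLog s (w i)
      ≤ (ρ * cfc (deformedLog s) Ω).trace.re := by
  have hH := hΩ.1
  rw [re_trace_mul_cfc hH]
  -- The second family is the spectral distribution of Ω under ρ. Both masses equal Tr ρ, the means
  -- compare because Ω ≥ ∑ wᵢ Mᵢ, and the resolvents by Jensen for the inverse of u + Ω.
  refine sum_mul_deformedLog_le hw hΩ.eigenvalues_pos ?_ ?_ ?_ hs hs'
  · rw [sum_re_trace_mul_of_isPOVM hM, sum_re_trace_mul_of_isPOVM (isPOVM_spectralProj hH)]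
  · rw [← re_trace_mul_sum_smul, ← re_trace_mul_sum_smul, sum_eigenvalues_smul_spectralProj,
      ← sub_nonneg, ← Complex.sub_re, ← Matrix.trace_sub, ← mul_sub]
    exact trace_mul_re_nonneg hρ hle
  · intro u hu
    rw [← re_trace_mul_cfc hH ρ (fun t => (u + t)⁻¹), ← re_trace_mul_sum_smul,
      ← sub_nonneg, ← Complex.sub_re, ← Matrix.trace_sub, ← mul_sub]
    refine trace_mul_re_nonneg hρ (posSemidef_sum_inv_smul_sub hM
      (fun i => by have := hw i; positivity) (Ω := u • 1 + Ω) ?_ (cfc_predicate _ Ω) ?_)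
    · simp_rw [add_smul, Finset.sum_add_distrib, ← Finset.smul_sum, hM.2]
      simpa using hle
    · have e : u • 1 + Ω = cfc (fun t => u + t) Ω := by
        rw [cfc_eq_sum_spectralProj hH]
        simp_rw [add_smul, Finset.sum_add_distrib, sum_eigenvalues_smul_spectralProj,
          ← Finset.smul_sum, (isPOVM_spectralProj hH).2]
      rw [e, hH.cfc_eq, hH.cfc_eq, Matrix.IsHermitian.cfc, Matrix.IsHermitian.cfc, ← map_mul,
        Matrix.diagonal_mul_diagonal, ← map_one (Unitary.conjStarAlgAut ℂ _ hH.eigenvectorUnitary),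
        ← Matrix.diagonal_one]
      congr 2
      ext j
      have : u + hH.eigenvalues j ≠ 0 := by
        have := hΩ.eigenvalues_pos j; positivity
      have h' : (u : ℂ) + hH.eigenvalues j ≠ 0 := by exact_mod_cast this
      simp [inv_mul_cancel₀ h']

end Spectral

/-! ### Block-diagonal operators -/

section ClassicalQuantum
variable {X B : Type*} [Fintype X] [DecidableEq X]

theorem cqOp_apply (A : X → Matrix B B ℂ) (i j : X × B) :
    cqOp A i j = if i.1 = j.1 then A i.1 i.2 j.2 else 0 := by
  simp only [cqOp, Matrix.sum_apply, Matrix.kroneckerMap_apply, Matrix.single_apply]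
  split_ifs with h
  · rw [Finset.sum_eq_single i.1]
    · simp [h]
    · intro x _ hx; simp [hx]
    · simp
  · refine Finset.sum_eq_zero fun x _ => ?_
    rw [if_neg (by rintro ⟨h1, h2⟩; exact h (h1.symm.trans h2)), zero_mul]

/-- The diagonal block of an operator on `H_X ⊗ H_B` at `x`. -/
def diagBlock (M : Matrix (X × B) (X × B) ℂ) (x : X) : Matrix B B ℂ :=
  M.submatrix (Prod.mk x) (Prod.mk x)

theorem diagBlock_cqOp (A : X → Matrix B B ℂ) (x : X) : diagBlock (cqOp A) x = A x := by
  ext i j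
  simp [diagBlock, cqOp_apply]

theorem cqOp_diagBlock_apply (M : Matrix (X × B) (X × B) ℂ) (i j : X × B) :
    cqOp (diagBlock M) i j = if i.1 = j.1 then M i j else 0 := by
  rw [cqOp_apply]
  split_ifs with h
  · simp only [diagBlock, Matrix.submatrix_apply]
    conv_rhs => rw [← Prod.mk.eta (p := i), ← Prod.mk.eta (p := j), ← h]
  · rfl

theorem cqOp_const [DecidableEq B] (σ : Matrix B B ℂ) :
    (1 : Matrix X X ℂ) ⊗ₖ σ = cqOp fun _ => σ := by
  ext i j
  rw [cqOp_apply, Matrix.kroneckerMap_apply, Matrix.one_apply]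
  split_ifs <;> simp

theorem cqOp_one [DecidableEq B] : cqOp (fun _ : X => (1 : Matrix B B ℂ)) = 1 := by
  rw [← cqOp_const, Matrix.one_kronecker_one]

theorem cqOp_add (A A' : X → Matrix B B ℂ) : cqOp (A + A') = cqOp A + cqOp A' := by
  ext i j
  simp only [Matrix.add_apply, cqOp_apply]
  split_ifs <;> simp

variable [Fintype B]

theorem trace_cqOp_mul (A : X → Matrix B B ℂ) (M : Matrix (X × B) (X × B) ℂ) :
    (cqOp A * M).trace = ∑ x, (A x * diagBlock M x).trace := by
  simp only [Matrix.trace, Matrix.diag_apply, Matrix.mul_apply, Fintype.sum_prod_type, cqOp_apply,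
    diagBlock, Matrix.submatrix_apply, ite_mul, zero_mul]
  refine Finset.sum_congr rfl fun x _ => Finset.sum_congr rfl fun i _ => ?_
  rw [Finset.sum_comm]
  simp

theorem trace_cqOp_mul_cqOp (A E : X → Matrix B B ℂ) :
    (cqOp A * cqOp E).trace = ∑ x, (A x * E x).trace := by
  simp_rw [trace_cqOp_mul, diagBlock_cqOp]

theorem trace_cqOp (A : X → Matrix B B ℂ) : (cqOp A).trace = ∑ x, (A x).trace := by
  classical
  simpa [cqOp_one] using trace_cqOp_mul_cqOp A (fun _ => 1)

theorem trace_cqOp_mul_cqOp_diagBlock (A : X → Matrix B B ℂ) (M : Matrix (X × B) (X × B) ℂ) :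
    (cqOp A * cqOp (diagBlock M)).trace = (cqOp A * M).trace := by
  rw [trace_cqOp_mul_cqOp, trace_cqOp_mul]

theorem posSemidef_cqOp {A : X → Matrix B B ℂ} (hA : ∀ x, (A x).PosSemidef) :
    (cqOp A).PosSemidef := by
  choose C hC using fun x => exists_eq_conjTranspose_mul_self (hA x)
  have : cqOp A = (cqOp C).conjTranspose * cqOp C := by
    ext i j
    simp only [Matrix.mul_apply, Matrix.conjTranspose_apply, cqOp_apply, Fintype.sum_prod_type, hC]
    rw [Finset.sum_eq_single i.1]
    · by_cases h : i.1 = j.1 <;> simp [h]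
    · intro x _ hx; simp [hx]
    · simp
  rw [this]
  exact Matrix.posSemidef_conjTranspose_mul_self _

theorem posDef_cqOp {A : X → Matrix B B ℂ} (hA : ∀ x, (A x).PosDef) : (cqOp A).PosDef := by
  classical
  refine (posSemidef_cqOp fun x => (hA x).posSemidef).posDef_iff_isUnit.2
    (IsUnit.of_mul_eq_one (cqOp fun x => (A x)⁻¹) ?_)
  ext i j
  have h : (A i.1 * (A i.1)⁻¹) i.2 j.2 = (1 : Matrix B B ℂ) i.2 j.2 := by
    rw [Matrix.mul_nonsing_inv _ ((Matrix.isUnit_iff_isUnit_det _).1 (hA i.1).isUnit)]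
  simp only [Matrix.mul_apply, cqOp_apply, Fintype.sum_prod_type] at h ⊢
  rw [Finset.sum_eq_single i.1]
  · by_cases hij : i.1 = j.1
    · simp [hij] at h ⊢
      rw [h, Matrix.one_apply, Matrix.one_apply]
      simp [Prod.ext_iff, hij]
    · simp [hij, Prod.ext_iff]
  · intro x _ hx; simp [Ne.symm hx]
  · simp

/-- Pinching does not change the statistics of a classical-quantum operator
(`trace_cqOp_mul_cqOp_diagBlock`), so a measurement may be replaced by its block-diagonal part. -/
theorem isPOVM_cqOp_diagBlock [DecidableEq B] {ι : Type*} [Fintype ι]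
    {M : ι → Matrix (X × B) (X × B) ℂ} (hM : IsPOVM M) :
    IsPOVM fun i => cqOp (diagBlock (M i)) := by
  refine ⟨fun i => posSemidef_cqOp fun x => (hM.1 i).submatrix _, ?_⟩
  ext i j
  simp only [Matrix.sum_apply, cqOp_diagBlock_apply]
  have := congrFun (congrFun hM.2 i) j
  rw [Matrix.sum_apply] at this
  by_cases h : i.1 = j.1
  · simpa [h] using this
  · simp [h, Prod.ext_iff]

theorem isDensity_cqState {p : X → ℝ} (hp : IsProb p) {ρ : X → Matrix B B ℂ}
    (hρ : ∀ x, IsDensity (ρ x)) : IsDensity (cqState p ρ) := by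
  refine ⟨posSemidef_cqOp fun x => (hρ x).1.smul (by exact_mod_cast hp.1 x), ?_⟩
  rw [cqState, trace_cqOp]
  simp only [Matrix.trace_smul, (hρ _).2, smul_eq_mul, mul_one]
  exact_mod_cast hp.2

end ClassicalQuantum

/-! ### Scalar properties of the deformed logarithm -/

section Scalar

/-- The right side is the tangent at 1 of a concave function. It makes the minimax inequality affine
in the state. -/
theorem deformedLog_le_sub_one {s t : ℝ} (hs' : s ≤ 1) (ht : 0 < t) :
    deformedLog s t ≤ t - 1 := by
  rcases lt_trichotomy s 0 with h | rfl | h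
  · rw [deformedLog_of_ne h.ne, div_le_iff_of_neg h, Real.rpow_def_of_pos ht]
    have h1 := Real.add_one_le_exp (Real.log t * s)
    have h2 := Real.log_le_sub_one_of_pos ht
    nlinarith
  · rw [deformedLog_zero]
    exact Real.log_le_sub_one_of_pos ht
  · rw [deformedLog_of_ne h.ne', div_le_iff₀ h]
    have := rpow_one_add_le_one_add_mul_self (s := t - 1) (by linarith) h.le hs'
    rw [add_sub_cancel] at this
    linarith

theorem deformedLog_mul {s t u : ℝ} (ht : 0 < t) (hu : 0 < u) :
    deformedLog s (t * u) = t ^ s * deformedLog s u + deformedLog s t := by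
  rcases eq_or_ne s 0 with rfl | hs
  · simp [deformedLog_zero, Real.log_mul ht.ne' hu.ne', add_comm]
  · simp only [deformedLog_of_ne hs, Real.mul_rpow ht.le hu.le]
    field_simp; ring

theorem rpow_eq_one_add_mul_deformedLog (s : ℝ) {t : ℝ} :
    t ^ s = 1 + s * deformedLog s t := by
  rcases eq_or_ne s 0 with rfl | hs
  · simp
  · exact (one_add_mul_deformedLog hs t).symm

end Scalar

/-! ### A state that serves all measurements -/

section Minimax
variable {X B : Type*} [Fintype X] [DecidableEq X] [Fintype B] [DecidableEq B]

theorem posDef_sum_smul {d ι : Type*} [Fintype d] [DecidableEq d] [Fintype ι]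
    {M : ι → Matrix d d ℂ} (hM : IsPOVM M) {w : ι → ℝ} (hw : ∀ i, 0 < w i) :
    (∑ i, w i • M i).PosDef := by
  obtain ⟨δ, hδ, hle⟩ : ∃ δ : ℝ, 0 < δ ∧ ∀ i, δ ≤ w i := by
    cases isEmpty_or_nonempty ι
    · exact ⟨1, one_pos, isEmptyElim⟩
    · obtain ⟨i, hi⟩ := Finite.exists_min w
      exact ⟨w i, hw i, hi⟩
  have : ∑ i, w i • M i = δ • 1 + ∑ i, (w i - δ) • M i := by
    simp_rw [sub_smul, Finset.sum_sub_distrib, ← Finset.smul_sum, hM.2]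
    abel
  rw [this]
  exact (Matrix.PosDef.one.smul hδ).add_posSemidef
    (Matrix.posSemidef_sum _ fun i _ => (hM.1 i).smul (sub_nonneg.2 (hle i)))

/-- Every weighted POVM on `H_X ⊗ H_B` is dominated by a POVM on `H_B` with outcomes in `X`,
after rescaling by the largest eigenvalue of its marginal. -/
theorem exists_isDensity_sum_mul_deformedLog_le [Nonempty X] [Nonempty B]
    {a : X → Matrix B B ℂ} (ha : IsDensity (cqOp a)) {s F : ℝ} (hs : -1 ≤ s) (hs' : s ≤ 1)
    (hsF : 0 ≤ 1 + s * F)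
    (hF : ∀ E : X → Matrix B B ℂ, IsPOVM E → (cqOp E).PosDef →
      (cqOp a * cfc (deformedLog s) (cqOp E)).trace.re ≤ F)
    {ι : Type*} [Fintype ι] {M : ι → Matrix (X × B) (X × B) ℂ} (hM : IsPOVM M) {w : ι → ℝ}
    (hw : ∀ i, 0 < w i) :
    ∃ σ, IsDensity σ ∧ ∑ i, (cqOp a * M i).trace.re * deformedLog s (w i)
      ≤ F + (1 + s * F) * ((cqOp (fun _ : X => σ) * ∑ i, w i • M i).trace.re - 1) := by
  set Z := ∑ i, w i • M i with hZ
  have hZpd : Z.PosDef := posDef_sum_smul hM hw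
  have hblk : ∀ x, (diagBlock Z x).PosDef := fun x =>
    hZpd.submatrix (Prod.mk_right_injective x)
  set H := ∑ x, diagBlock Z x with hH
  have hHpd : H.PosDef := Matrix.posDef_sum Finset.univ_nonempty fun x _ => hblk x
  -- The state σ attains the largest eigenvalue t of H, so H ≤ t, while t = Tr[(1 ⊗ σ) Z] is also
  -- the quantity in the claim.
  obtain ⟨σ, hσ, hle⟩ := exists_isDensity_posSemidef_sub hHpd.1
  refine ⟨σ, hσ, ?_⟩
  have ht : (σ * H).trace.re = (cqOp (fun _ : X => σ) * Z).trace.re := by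
    rw [trace_cqOp_mul, hH, Finset.mul_sum, Matrix.trace_sum]
  rw [ht] at hle
  set t := (cqOp (fun _ : X => σ) * Z).trace.re
  have htpos : 0 < t := by
    have h := (Matrix.PosDef.posSemidef_add hle hHpd).diag_pos (i := Classical.arbitrary B)
    rw [sub_add_cancel, Matrix.smul_apply, Matrix.one_apply_eq] at h
    simpa using h
  obtain ⟨x₀⟩ := ‹Nonempty X›
  -- The blocks of Z divided by t sum to H/t ≤ 1; the deficit is assigned to one arbitrary outcome.
  set R : X → Matrix B B ℂ := Pi.single x₀ (1 - t⁻¹ • H) with hR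
  have hRpos : ∀ x, (R x).PosSemidef := by
    intro x
    rcases eq_or_ne x x₀ with rfl | hx
    · have := hle.smul (inv_nonneg.2 htpos.le)
      rw [hR, Pi.single_eq_same]
      convert this using 1
      rw [smul_sub, smul_smul, inv_mul_cancel₀ htpos.ne', one_smul]
    · rw [hR, Pi.single_eq_of_ne hx]
      exact Matrix.PosSemidef.zero
  have hEpos : ∀ x, (t⁻¹ • diagBlock Z x).PosDef := fun x => (hblk x).smul (inv_pos.2 htpos)
  set E : X → Matrix B B ℂ := (fun x => t⁻¹ • diagBlock Z x) + R with hE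
  have hEpovm : IsPOVM E := by
    refine ⟨fun x => (hEpos x).posSemidef.add (hRpos x), ?_⟩
    simp only [hE, Pi.add_apply, Finset.sum_add_distrib, ← Finset.smul_sum, hR,
      Finset.sum_pi_single', Finset.mem_univ, if_true]
    rw [← hH]
    simp
  have hEpd : (cqOp E).PosDef := posDef_cqOp fun x => (hEpos x).add_posSemidef (hRpos x)
  have hsub : cqOp E - ∑ i, (w i / t) • cqOp (diagBlock (M i)) = cqOp R := by
    rw [sub_eq_iff_eq_add', hE, cqOp_add]
    congr 1
    ext i j
    simp only [cqOp_apply, Matrix.sum_apply, Matrix.smul_apply, hZ,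
      diagBlock, Matrix.submatrix_apply]
    split_ifs with h
    · rw [Finset.smul_sum]
      refine Finset.sum_congr rfl fun k _ => ?_
      rw [smul_smul, div_eq_inv_mul]
    · simp
  have hJ := (sum_mul_deformedLog_le_re_trace_mul_cfc (isPOVM_cqOp_diagBlock hM)
    (w := fun i => w i / t) (fun i => div_pos (hw i) htpos) hEpd
    (hsub ▸ posSemidef_cqOp hRpos) ha.1 hs hs').trans (hF E hEpovm hEpd)
  simp_rw [trace_cqOp_mul_cqOp_diagBlock] at hJ
  have hsum : ∑ i, (cqOp a * M i).trace.re = 1 := by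
    rw [sum_re_trace_mul_of_isPOVM hM, ha.2, Complex.one_re]
  -- Undo the division by t with ln_s(tu) = t^s ln_s u + ln_s t, then substitute t^s = 1 + s ln_s t
  -- and bound ln_s t by t - 1.
  calc ∑ i, (cqOp a * M i).trace.re * deformedLog s (w i)
      = t ^ s * ∑ i, (cqOp a * M i).trace.re * deformedLog s (w i / t)
        + deformedLog s t := by
        rw [Finset.mul_sum, ← one_mul (deformedLog s t), ← hsum, Finset.sum_mul,
          ← Finset.sum_add_distrib]
        refine Finset.sum_congr rfl fun i _ => ?_
        rw [show w i = t * (w i / t) by field_simp, deformedLog_mul htpos (div_pos (hw i) htpos),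
          show t * (w i / t) / t = w i / t by field_simp]
        ring
    _ ≤ t ^ s * F + deformedLog s t := by gcongr
    _ = F + (1 + s * F) * deformedLog s t := by
        rw [rpow_eq_one_add_mul_deformedLog s]; ring
    _ ≤ F + (1 + s * F) * (t - 1) := by
        gcongr
        exact deformedLog_le_sub_one hs' htpos

/-- A universal side-information state: one state `σ` works for all weighted POVMs. -/
theorem exists_isDensity_forall_sum_mul_deformedLog_le [Nonempty X] [Nonempty B]
    {a : X → Matrix B B ℂ} (ha : IsDensity (cqOp a)) {s F : ℝ} (hs : -1 ≤ s) (hs' : s ≤ 1)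
    (hsF : 0 ≤ 1 + s * F)
    (hF : ∀ E : X → Matrix B B ℂ, IsPOVM E → (cqOp E).PosDef →
      (cqOp a * cfc (deformedLog s) (cqOp E)).trace.re ≤ F) :
    ∃ σ : Matrix B B ℂ, IsDensity σ ∧ ∀ (n : ℕ) (M : Fin n → Matrix (X × B) (X × B) ℂ),
      IsPOVM M → ∀ w : Fin n → ℝ, (∀ i, 0 < w i) →
      ∑ i, (cqOp a * M i).trace.re * deformedLog s (w i)
        ≤ F + (1 + s * F) * (∑ i, (cqOp (fun _ : X => σ) * M i).trace.re * w i - 1) := by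
  -- These pairs carry the whole dependence on (M, w). Arbitrary finite outcome types make C convex:
  -- a mixture of two POVMs lives on the disjoint union of their outcomes.
  let C : Set (Matrix (X × B) (X × B) ℂ × ℝ) := {c | ∃ (ι : Type) (_ : Fintype ι)
    (M : ι → Matrix (X × B) (X × B) ℂ) (w : ι → ℝ), IsPOVM M ∧ (∀ i, 0 < w i) ∧
    c = (∑ i, w i • M i, ∑ i, (cqOp a * M i).trace.re * deformedLog s (w i))}
  have hC : Convex ℝ C := by
    rintro _ ⟨ι, _, M, w, hM, hw, rfl⟩ _ ⟨κ, _, N, v, hN, hv, rfl⟩ x y hx hy hxy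
    refine ⟨ι ⊕ κ, inferInstance, Sum.elim (fun i => x • M i) (fun j => y • N j),
      Sum.elim w v, ⟨?_, ?_⟩, ?_, ?_⟩
    · rintro (i | j)
      · exact (hM.1 i).smul hx
      · exact (hN.1 j).smul hy
    · simp [← Finset.smul_sum, hM.2, hN.2, ← add_smul, hxy]
    · rintro (i | j)
      · exact hw i
      · exact hv j
    · simp [Finset.smul_sum, Finset.mul_sum, smul_comm _ x, smul_comm _ y, mul_assoc]
  let f : Matrix B B ℂ → Matrix (X × B) (X × B) ℂ × ℝ → ℝ := fun σ c =>
    c.2 - F - (1 + s * F) * ((((1 : Matrix X X ℂ) ⊗ₖ σ) * c.1).trace.re - 1)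
  have hf₁ : ∀ c, ∃ (L : Matrix B B ℂ →ₗ[ℝ] ℝ) (b : ℝ), ∀ σ, f σ c = L σ + b := by
    intro c
    refine ⟨-(1 + s * F) • (Complex.reLm ∘ₗ (Matrix.traceLinearMap (X × B) ℝ ℂ) ∘ₗ
      (LinearMap.mulRight ℝ c.1) ∘ₗ
      (Matrix.kroneckerMapBilinear (LinearMap.mul ℝ ℂ) (1 : Matrix X X ℂ))),
      c.2 - F + (1 + s * F), fun σ => ?_⟩
    simp [f]
    ring
  have hf₂ : ∀ σ, ∃ (L : Matrix (X × B) (X × B) ℂ × ℝ →ₗ[ℝ] ℝ) (b : ℝ),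
      ∀ c, f σ c = L c + b := by
    intro σ
    refine ⟨LinearMap.snd ℝ _ _ - (1 + s * F) • (Complex.reLm ∘ₗ
      (Matrix.traceLinearMap (X × B) ℝ ℂ) ∘ₗ (LinearMap.mulLeft ℝ ((1 : Matrix X X ℂ) ⊗ₖ σ)) ∘ₗ
      LinearMap.fst ℝ _ _), - F + (1 + s * F), fun c => ?_⟩
    simp [f]
    ring
  obtain ⟨σ, hσ, h⟩ := exists_forall_nonpos_of_forall_exists (V := Matrix B B ℂ)
    (K := {σ | IsDensity σ}) (C := C) (f := f)
    exists_isDensity isCompact_setOf_isDensity convex_setOf_isDensity hC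
    (fun c => by
      obtain ⟨L, b, h⟩ := hf₁ c
      simp_rw [h]
      exact L.continuous_of_finiteDimensional.add continuous_const)
    (fun σ => by
      obtain ⟨L, b, h⟩ := hf₂ σ
      simp_rw [funext h]
      exact L.continuous_of_finiteDimensional.add continuous_const)
    (fun c => by
      obtain ⟨L, b, h⟩ := hf₁ c
      simp_rw [h]
      exact (L.convexOn convex_setOf_isDensity).add_const b)
    (fun σ => by
      obtain ⟨L, b, h⟩ := hf₂ σ
      simp_rw [funext h]
      exact (L.concaveOn hC).add_const b)
    (by
      rintro _ ⟨ι, _, M, w, hM, hw, rfl⟩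
      obtain ⟨σ, hσ, h⟩ := exists_isDensity_sum_mul_deformedLog_le ha hs hs' hsF hF hM hw
      refine ⟨σ, hσ, ?_⟩
      simp only [f, cqOp_const]
      linarith)
  refine ⟨σ, hσ, fun n M hM w hw => ?_⟩
  have := h _ ⟨Fin n, inferInstance, M, w, hM, hw, rfl⟩
  simp only [f, cqOp_const, re_trace_mul_sum_smul] at this
  linarith

end Minimax

/-! ### Variational bounds for the classical divergence -/

section ClassicalDivergence

theorem ennreal_rpow_le_rpow_of_nonpos {x y : ℝ≥0∞} (h : x ≤ y) {z : ℝ} (hz : z ≤ 0) :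
    y ^ z ≤ x ^ z := by
  rw [← neg_neg z, ENNReal.rpow_neg _ (-z), ENNReal.rpow_neg _ (-z), ENNReal.inv_le_inv]
  exact ENNReal.rpow_le_rpow h (neg_nonneg.2 hz)

/-- The sum in the Rényi divergence of order `a`. -/
noncomputable def renyiSum {ι : Type*} [Fintype ι] (a : ℝ) (p q : ι → ℝ) : ℝ :=
  ∑ i, p i ^ a * q i ^ (1 - a)

variable {ι : Type*} [Fintype ι] {p q : ι → ℝ}

theorem renyiSum_nonneg (hp : ∀ i, 0 ≤ p i) (hq : ∀ i, 0 ≤ q i) (a : ℝ) :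
    0 ≤ renyiSum a p q :=
  Finset.sum_nonneg fun i _ =>
    mul_nonneg (Real.rpow_nonneg (hp i) _) (Real.rpow_nonneg (hq i) _)

theorem sum_ofReal_rpow_mul_eq (hp : ∀ i, 0 ≤ p i) (hq : ∀ i, 0 ≤ q i) {a : ℝ} (ha : 0 < a)
    (h : a < 1 ∨ ∀ i, q i = 0 → p i = 0) :
    ∑ i, ENNReal.ofReal (p i) ^ a * ENNReal.ofReal (q i) ^ (1 - a)
      = ENNReal.ofReal (renyiSum a p q) := by
  rw [renyiSum, ENNReal.ofReal_sum_of_nonneg fun i _ =>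
    mul_nonneg (Real.rpow_nonneg (hp i) _) (Real.rpow_nonneg (hq i) _)]
  refine Finset.sum_congr rfl fun i _ => ?_
  rw [ENNReal.ofReal_mul (Real.rpow_nonneg (hp i) _),
    ENNReal.ofReal_rpow_of_nonneg (hp i) ha.le]
  rcases h with h | h
  · rw [ENNReal.ofReal_rpow_of_nonneg (hq i) (by linarith)]
  · rcases (hq i).eq_or_lt with h0 | h0
    · simp [h i h0.symm, Real.zero_rpow ha.ne']
    · rw [ENNReal.ofReal_rpow_of_pos h0]

theorem renyiDiv_eq_log {α : ℝ≥0∞} (h1 : α ≠ 1) (htop : α ≠ ⊤) (p q : ι → ℝ) :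
    renyiDiv α p q = ENNReal.log ((∑ i, ENNReal.ofReal (p i) ^ α.toReal *
      ENNReal.ofReal (q i) ^ (1 - α.toReal)) ^ (α.toReal - 1)⁻¹) := by
  rw [renyiDiv, if_neg htop, if_neg h1, ENNReal.log_rpow]

theorem gainFactor_mul_log {α : ℝ≥0∞} (htop : α ≠ ⊤) (G : ℝ≥0∞) :
    (gainFactor α : EReal) * ENNReal.log G
      = ENNReal.log ((G ^ α.toReal) ^ (α.toReal - 1)⁻¹) := by
  rw [gainFactor, if_neg htop, ← ENNReal.log_rpow, ← ENNReal.rpow_mul, div_eq_mul_inv]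

/-! ### Lower bounds on the classical divergence -/

/-- Hölder's inequality. -/
theorem sum_mul_rpow_le_renyiSum_rpow (hp : ∀ i, 0 ≤ p i) (hq : ∀ i, 0 ≤ q i)
    (hpq : ∀ i, q i = 0 → p i = 0) {w : ι → ℝ} (hw : ∀ i, 0 ≤ w i) (hqw : ∑ i, q i * w i = 1)
    {a : ℝ} (ha : 1 < a) :
    (∑ i, p i * w i ^ ((a - 1) / a)) ^ a ≤ renyiSum a p q := by
  have ha0 : 0 < a := by linarith
  set s := (a - 1) / a with hs
  have hs0 : 0 < s := div_pos (by linarith) ha0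
  have hsa : s * a = a - 1 := by rw [hs]; field_simp
  have hconj : a.HolderConjugate s⁻¹ := by
    rw [Real.holderConjugate_iff]
    refine ⟨ha, ?_⟩
    rw [inv_inv, hs]; field_simp; ring
  -- The factors p q^(-s) and (q w)^s, with exponents a and 1/s, have product p w^s because p ≪ q.
  have H := Real.inner_le_Lp_mul_Lq_of_nonneg Finset.univ hconj
    (f := fun i => p i * q i ^ (-s)) (g := fun i => (q i * w i) ^ s)
    (fun i _ => mul_nonneg (hp i) (Real.rpow_nonneg (hq i) _))
    (fun i _ => Real.rpow_nonneg (mul_nonneg (hq i) (hw i)) _)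
  have e1 : ∀ i, p i * q i ^ (-s) * (q i * w i) ^ s = p i * w i ^ s := by
    intro i
    rcases (hq i).eq_or_lt with h0 | h0
    · simp [hpq i h0.symm]
    · rw [Real.mul_rpow (hq i) (hw i), Real.rpow_neg (hq i)]
      have := (Real.rpow_pos_of_pos h0 s).ne'
      field_simp
  have e2 : ∀ i, (p i * q i ^ (-s)) ^ a = p i ^ a * q i ^ (1 - a) := by
    intro i
    rw [Real.mul_rpow (hp i) (Real.rpow_nonneg (hq i) _), ← Real.rpow_mul (hq i)]
    congr 2; linarith
  have e3 : ∀ i, ((q i * w i) ^ s) ^ s⁻¹ = q i * w i := fun i =>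
    Real.rpow_rpow_inv (mul_nonneg (hq i) (hw i)) hs0.ne'
  simp only [e1, e2, e3, hqw, Real.one_rpow, mul_one, ← renyiSum.eq_1] at H
  have H' := Real.rpow_le_rpow (Finset.sum_nonneg fun i _ =>
    mul_nonneg (hp i) (Real.rpow_nonneg (hw i) _)) H ha0.le
  rwa [one_div, Real.rpow_inv_rpow (renyiSum_nonneg hp hq a) ha0.ne'] at H'

/-- Reverse Hölder's inequality. -/
theorem renyiSum_le_sum_mul_rpow_rpow (hp : ∀ i, 0 ≤ p i) (hq : ∀ i, 0 ≤ q i)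
    {w : ι → ℝ} (hw : ∀ i, 0 ≤ w i) (hpw : ∀ i, w i = 0 → p i = 0) (hqw : ∑ i, q i * w i = 1)
    {a : ℝ} (ha0 : 0 < a) (ha : a < 1) :
    renyiSum a p q ≤ (∑ i, p i * w i ^ ((a - 1) / a)) ^ a := by
  set s := (a - 1) / a with hs
  have hsa : s * a = a - 1 := by rw [hs]; field_simp
  have h1a : 0 < 1 - a := by linarith
  have hconj : (a⁻¹).HolderConjugate (1 - a)⁻¹ := by
    rw [Real.holderConjugate_iff]
    exact ⟨(one_lt_inv₀ ha0).2 ha, by rw [inv_inv, inv_inv]; ring⟩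
  -- Here the weights cancel from the product, as s a = a - 1.
  have H := Real.inner_le_Lp_mul_Lq_of_nonneg Finset.univ hconj
    (f := fun i => (p i * w i ^ s) ^ a) (g := fun i => (q i * w i) ^ (1 - a))
    (fun i _ => Real.rpow_nonneg (mul_nonneg (hp i) (Real.rpow_nonneg (hw i) _)) _)
    (fun i _ => Real.rpow_nonneg (mul_nonneg (hq i) (hw i)) _)
  have e1 : ∀ i, (p i * w i ^ s) ^ a * (q i * w i) ^ (1 - a) = p i ^ a * q i ^ (1 - a) := by
    intro i
    rcases (hw i).eq_or_lt with h0 | h0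
    · simp [hpw i h0.symm, Real.zero_rpow ha0.ne']
    · rw [Real.mul_rpow (hp i) (Real.rpow_nonneg (hw i) _), Real.mul_rpow (hq i) (hw i),
        ← Real.rpow_mul (hw i), hsa, show 1 - a = -(a - 1) by ring, Real.rpow_neg (hw i)]
      have := (Real.rpow_pos_of_pos h0 (a - 1)).ne'
      field_simp
  have e2 : ∀ i, ((p i * w i ^ s) ^ a) ^ a⁻¹ = p i * w i ^ s := fun i =>
    Real.rpow_rpow_inv (mul_nonneg (hp i) (Real.rpow_nonneg (hw i) _)) ha0.ne'
  have e3 : ∀ i, ((q i * w i) ^ (1 - a)) ^ (1 - a)⁻¹ = q i * w i := fun i =>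
    Real.rpow_rpow_inv (mul_nonneg (hq i) (hw i)) h1a.ne'
  simpa only [e1, e2, e3, hqw, Real.one_rpow, mul_one, one_div, inv_inv, ← renyiSum.eq_1] using H

theorem ofReal_sum_mul_le_iSup_div (hp : ∀ i, 0 ≤ p i) (hq : ∀ i, 0 ≤ q i) {w : ι → ℝ}
    (hw : ∀ i, 0 ≤ w i) (hqw : ∑ i, q i * w i = 1) :
    ENNReal.ofReal (∑ i, p i * w i) ≤ ⨆ i, ENNReal.ofReal (p i) / ENNReal.ofReal (q i) := by
  set T := ⨆ i, ENNReal.ofReal (p i) / ENNReal.ofReal (q i)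
  by_cases hT : T = ⊤
  · simp [hT]
  have key : ∀ i, ENNReal.ofReal (p i) ≤ T * ENNReal.ofReal (q i) := by
    intro i
    have h : ENNReal.ofReal (p i) / ENNReal.ofReal (q i) ≤ T :=
      le_iSup (fun i => ENNReal.ofReal (p i) / ENNReal.ofReal (q i)) i
    exact (ENNReal.div_le_iff_le_mul (Or.inr hT) (Or.inl ENNReal.ofReal_ne_top)).1 h
  rw [ENNReal.ofReal_sum_of_nonneg fun i _ => mul_nonneg (hp i) (hw i)]
  calc ∑ i, ENNReal.ofReal (p i * w i)
      ≤ ∑ i, T * ENNReal.ofReal (q i * w i) := by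
        refine Finset.sum_le_sum fun i _ => ?_
        rw [ENNReal.ofReal_mul (hp i), ENNReal.ofReal_mul (hq i), ← mul_assoc]
        gcongr
        exact key i
    _ = T := by
        rw [← Finset.mul_sum, ← ENNReal.ofReal_sum_of_nonneg fun i _ => mul_nonneg (hq i) (hw i),
          hqw, ENNReal.ofReal_one, mul_one]

theorem gainFactor_mul_log_le_renyiDiv (hp : ∀ i, 0 ≤ p i) (hq : ∀ i, 0 ≤ q i)
    {w : ι → ℝ} (hw : ∀ i, 0 ≤ w i) (hqw : ∑ i, q i * w i = 1) {α : ℝ≥0∞} (h0 : α ≠ 0)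
    (h1 : α ≠ 1) (hpw : α < 1 → ∀ i, w i = 0 → p i = 0) :
    (gainFactor α : EReal) * ENNReal.log (ENNReal.ofReal (∑ i, p i * w i ^ gainExponent α))
      ≤ renyiDiv α p q := by
  by_cases htop : α = ⊤
  · subst htop
    simp only [gainFactor, gainExponent, if_true, renyiDiv, Real.rpow_one, EReal.coe_one, one_mul]
    exact ENNReal.log_le_log (ofReal_sum_mul_le_iSup_div hp hq hw hqw)
  have ha0 : 0 < α.toReal := ENNReal.toReal_pos h0 htop
  rw [gainFactor_mul_log htop, renyiDiv_eq_log h1 htop, gainExponent, if_neg htop,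
    ENNReal.ofReal_rpow_of_nonneg (Finset.sum_nonneg fun i _ =>
      mul_nonneg (hp i) (Real.rpow_nonneg (hw i) _)) ha0.le]
  refine ENNReal.log_le_log ?_
  rcases lt_or_gt_of_ne h1 with h | h
  · have ha : α.toReal < 1 := by
      simpa using (ENNReal.toReal_lt_toReal htop ENNReal.one_ne_top).2 h
    refine ennreal_rpow_le_rpow_of_nonpos ?_ (inv_nonpos.2 (by linarith))
    rw [sum_ofReal_rpow_mul_eq hp hq ha0 (Or.inl ha)]
    exact ENNReal.ofReal_le_ofReal (renyiSum_le_sum_mul_rpow_rpow hp hq hw (hpw h) hqw ha0 ha)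
  · have ha : 1 < α.toReal := by
      simpa using (ENNReal.toReal_lt_toReal ENNReal.one_ne_top htop).2 h
    refine ENNReal.rpow_le_rpow ?_ (inv_nonneg.2 (by linarith))
    by_cases hpq : ∀ i, q i = 0 → p i = 0
    · rw [sum_ofReal_rpow_mul_eq hp hq ha0 (Or.inr hpq)]
      exact ENNReal.ofReal_le_ofReal (sum_mul_rpow_le_renyiSum_rpow hp hq hpq hw hqw ha)
    · push Not at hpq
      obtain ⟨i, hqi, hpi⟩ := hpq
      refine le_top.trans_eq (Eq.symm (ENNReal.sum_eq_top.2 ⟨i, Finset.mem_univ i, ?_⟩))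
      rw [hqi, ENNReal.ofReal_zero, ENNReal.zero_rpow_of_neg (by linarith), ENNReal.mul_top]
      have : 0 < p i := (hp i).lt_of_ne' hpi
      simp [ENNReal.rpow_eq_zero_iff, this]

/-- Gibbs' inequality: log x ≤ x - 1 at x = w q / p, averaged over p. -/
theorem sum_mul_log_le_renyiDiv_one (hp : ∀ i, 0 ≤ p i) (hp1 : ∑ i, p i = 1)
    (hq : ∀ i, 0 ≤ q i) {w : ι → ℝ} (hw : ∀ i, 0 ≤ w i) (hpw : ∀ i, w i = 0 → p i = 0)
    (hqw : ∑ i, q i * w i = 1) :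
    ((∑ i, p i * Real.log (w i) : ℝ) : EReal) ≤ renyiDiv 1 p q := by
  rw [renyiDiv, if_neg ENNReal.one_ne_top, if_pos rfl]
  split_ifs with hpq
  · rw [EReal.coe_le_coe_iff, ← sub_nonpos, ← Finset.sum_sub_distrib]
    calc ∑ i, (p i * Real.log (w i) - p i * Real.log (p i / q i))
        ≤ ∑ i, (q i * w i - p i) := by
          refine Finset.sum_le_sum fun i _ => ?_
          rcases (hp i).eq_or_lt with h | h
          · simpa [← h] using mul_nonneg (hq i) (hw i)
          · have hqi : 0 < q i := (hq i).lt_of_ne' fun h' => h.ne' (hpq i h')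
            have hwi : 0 < w i := (hw i).lt_of_ne' fun h' => h.ne' (hpw i h')
            have := Real.log_le_sub_one_of_pos (x := w i / (p i / q i)) (by positivity)
            rw [Real.log_div hwi.ne' (by positivity)] at this
            calc _ = p i * (Real.log (w i) - Real.log (p i / q i)) := by ring
              _ ≤ p i * (w i / (p i / q i) - 1) := by gcongr
              _ = q i * w i - p i := by field_simp
      _ = 0 := by rw [Finset.sum_sub_distrib, hqw, hp1, sub_self]
  · exact le_top

/-! ### Upper bounds on the classical divergence -/

/-- Equality in Hölder holds at w = (p/q)^a. The shift by ε keeps the weights positive and finite;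
this limit is that of their normalisation. -/
theorem tendsto_sum_regularized (hp : ∀ i, 0 ≤ p i) (hq : ∀ i, 0 ≤ q i) {a : ℝ} (ha0 : 0 < a)
    (h : a < 1 ∨ ∀ i, q i = 0 → p i = 0) :
    Tendsto (fun ε => ∑ i, q i * ((p i + ε) / (q i + ε)) ^ a) (𝓝[>] 0)
      (𝓝 (renyiSum a p q)) := by
  refine tendsto_finsetSum _ fun i _ => ?_
  rcases (hq i).eq_or_lt with h0 | h0
  · have : p i ^ a * q i ^ (1 - a) = 0 := by
      rcases h with h | h
      · rw [← h0, Real.zero_rpow (by linarith), mul_zero]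
      · rw [h i h0.symm, Real.zero_rpow ha0.ne', zero_mul]
    rw [this]
    simp [← h0]
  · have e : p i ^ a * q i ^ (1 - a) = q i * ((p i + 0) / (q i + 0)) ^ a := by
      rw [add_zero, add_zero, Real.div_rpow (hp i) h0.le, Real.rpow_sub h0, Real.rpow_one]
      ring
    rw [e]
    refine Tendsto.mono_left (ContinuousAt.tendsto (f := fun ε =>
      q i * ((p i + ε) / (q i + ε)) ^ a) ?_) nhdsWithin_le_nhds
    refine continuousAt_const.mul (ContinuousAt.rpow_const ?_ (Or.inr ha0.le))
    exact ContinuousAt.div (by fun_prop) (by fun_prop) (by simpa using h0.ne')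

theorem tendsto_sum_regularized_rpow (hp : ∀ i, 0 ≤ p i) (hq : ∀ i, 0 ≤ q i) {a : ℝ}
    (ha0 : 0 < a) (h : a < 1 ∨ ∀ i, q i = 0 → p i = 0) :
    Tendsto (fun ε => ∑ i, p i * (((p i + ε) / (q i + ε)) ^ a) ^ ((a - 1) / a)) (𝓝[>] 0)
      (𝓝 (renyiSum a p q)) := by
  refine tendsto_finsetSum _ fun i _ => ?_
  rcases (hp i).eq_or_lt with h0 | h0
  · simp [← h0, Real.zero_rpow ha0.ne']
  · have e : p i ^ a * q i ^ (1 - a) = p i * ((q i + 0) / (p i + 0)) ^ (1 - a) := by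
      rw [add_zero, add_zero, Real.div_rpow (hq i) h0.le, Real.rpow_sub h0, Real.rpow_one]
      field_simp
    rw [e]
    have : Tendsto (fun ε => p i * ((q i + ε) / (p i + ε)) ^ (1 - a)) (𝓝[>] 0)
        (𝓝 (p i * ((q i + 0) / (p i + 0)) ^ (1 - a))) := by
      refine Tendsto.mono_left (ContinuousAt.tendsto (f := fun ε =>
        p i * ((q i + ε) / (p i + ε)) ^ (1 - a)) ?_) nhdsWithin_le_nhds
      refine continuousAt_const.mul (ContinuousAt.rpow_const
        (ContinuousAt.div (by fun_prop) (by fun_prop) (by simpa using h0.ne')) ?_)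
      rcases h with h | h
      · exact Or.inr (by linarith)
      · have : q i ≠ 0 := fun h' => h0.ne' (h i h')
        simp [this, h0.ne']
    refine this.congr' ?_
    filter_upwards [self_mem_nhdsWithin] with ε (hε : 0 < ε)
    have hpε : 0 < p i + ε := by positivity
    have hqε : 0 < q i + ε := add_pos_of_nonneg_of_pos (hq i) hε
    rw [← Real.rpow_mul (div_pos hpε hqε).le, mul_div_cancel₀ _ ha0.ne', ← inv_div,
      Real.inv_rpow (div_pos hpε hqε).le, ← Real.rpow_neg (div_pos hpε hqε).le, neg_sub]

variable {F s : ℝ}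

theorem sum_mul_deformedLog_div_le (hq : ∀ i, 0 ≤ q i) (hq0 : 0 < ∑ i, q i)
    (H : ∀ w : ι → ℝ, (∀ i, 0 < w i) → ∑ i, q i * w i = 1 →
      ∑ i, p i * deformedLog s (w i) ≤ F) {w : ι → ℝ} (hw : ∀ i, 0 < w i) :
    0 < ∑ i, q i * w i ∧
      ∑ i, p i * deformedLog s (w i / ∑ j, q j * w j) ≤ F := by
  have hQ : 0 < ∑ i, q i * w i := by
    obtain ⟨i, hi, h⟩ : ∃ i ∈ Finset.univ, 0 < q i := by
      by_contra! h
      exact hq0.not_ge (Finset.sum_nonpos h)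
    exact Finset.sum_pos' (fun i _ => mul_nonneg (hq i) (hw i).le) ⟨i, hi, mul_pos h (hw i)⟩
  refine ⟨hQ, H _ (fun i => div_pos (hw i) hQ) ?_⟩
  simp_rw [mul_div_assoc', ← Finset.sum_div]
  exact div_self hQ.ne'

theorem tendsto_deformedLog_atTop (hs : 0 ≤ s) : Tendsto (deformedLog s) atTop atTop := by
  rcases hs.eq_or_lt with rfl | hs
  · simpa only [funext deformedLog_zero] using Real.tendsto_log_atTop
  · simp_rw [funext (deformedLog_of_ne hs.ne')]
    exact (tendsto_atTop_add_const_right _ (-1) (tendsto_rpow_atTop hs)).atTop_div_const hs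

/-- Where q vanishes the weight is unconstrained, and ln_s is unbounded above for s ≥ 0, so any mass
of p there would violate the bound F. -/
theorem eq_zero_of_sum_mul_deformedLog_le (hp : ∀ i, 0 ≤ p i) (hq : ∀ i, 0 ≤ q i)
    (hq0 : 0 < ∑ i, q i) (hs : 0 ≤ s)
    (H : ∀ w : ι → ℝ, (∀ i, 0 < w i) → ∑ i, q i * w i = 1 →
      ∑ i, p i * deformedLog s (w i) ≤ F) (i : ι) (hqi : q i = 0) : p i = 0 := by
  classical
  by_contra hpi
  have hpi : 0 < p i := (hp i).lt_of_ne' hpi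
  set c := ∑ j ∈ Finset.univ.erase i, p j * deformedLog s (1 / ∑ j, q j)
  have key : ∀ t : ℝ, 0 < t → p i * deformedLog s (t / ∑ j, q j) + c ≤ F := by
    intro t ht
    have hw : ∀ j, 0 < Function.update (fun _ => (1 : ℝ)) i t j := fun j => by
      rcases eq_or_ne j i with rfl | h <;> simp [*]
    have hQ : ∑ j, q j * Function.update (fun _ => (1 : ℝ)) i t j = ∑ j, q j :=
      Finset.sum_congr rfl fun j _ => by
        rcases eq_or_ne j i with rfl | h <;> simp [*]
    have := (sum_mul_deformedLog_div_le hq hq0 H hw).2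
    rw [hQ, ← Finset.add_sum_erase _ _ (Finset.mem_univ i), Function.update_self] at this
    refine le_trans (le_of_eq ?_) this
    congr 1
    refine Finset.sum_congr rfl fun j hj => ?_
    rw [Function.update_of_ne (Finset.ne_of_mem_erase hj)]
  have lim : Tendsto (fun t => p i * deformedLog s (t / ∑ j, q j) + c) atTop atTop :=
    tendsto_atTop_add_const_right _ _ (((tendsto_deformedLog_atTop hs).comp
      (tendsto_id.atTop_div_const hq0)).const_mul_atTop hpi)
  obtain ⟨t, h1, h2⟩ := ((lim.eventually_gt_atTop F).and (eventually_gt_atTop 0)).exists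
  exact absurd (key t h2) (not_le.2 h1)

theorem sum_mul_rpow_div_rpow (hp1 : ∑ i, p i = 1) (hs : s ≠ 0) {w : ι → ℝ}
    (hw : ∀ i, 0 < w i) {Q : ℝ} (hQ : 0 < Q) :
    1 + s * ∑ i, p i * deformedLog s (w i / Q) = (∑ i, p i * w i ^ s) / Q ^ s := by
  rw [← hp1, Finset.mul_sum, ← Finset.sum_add_distrib, Finset.sum_div]
  refine Finset.sum_congr rfl fun i _ => ?_
  rw [mul_left_comm, ← mul_one_add, one_add_mul_deformedLog hs, Real.div_rpow (hw i).le hQ.le]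
  ring

theorem renyiDiv_le_gainFactor_mul_log (hp : ∀ i, 0 ≤ p i) (hp1 : ∑ i, p i = 1)
    (hq : ∀ i, 0 ≤ q i) (hq0 : 0 < ∑ i, q i) {α : ℝ≥0∞} (h0 : α ≠ 0) (h1 : α ≠ 1)
    (hG : 0 < 1 + gainExponent α * F)
    (H : ∀ w : ι → ℝ, (∀ i, 0 < w i) → ∑ i, q i * w i = 1 →
      ∑ i, p i * deformedLog (gainExponent α) (w i) ≤ F) :
    renyiDiv α p q
      ≤ (gainFactor α : EReal) * ENNReal.log (ENNReal.ofReal (1 + gainExponent α * F)) := by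
  classical
  by_cases htop : α = ⊤
  · subst htop
    simp only [gainFactor, gainExponent, if_true, renyiDiv, EReal.coe_one, one_mul] at *
    refine ENNReal.log_le_log (iSup_le fun i => ENNReal.div_le_of_le_mul ?_)
    rw [← ENNReal.ofReal_mul hG.le]
    refine ENNReal.ofReal_le_ofReal ?_
    -- At α = ∞ the near-optimal weights are a point mass at i, shifted by ε.
    have key : ∀ ε : ℝ, 0 < ε → p i + ε ≤ (1 + F) * (q i + ε * ∑ j, q j) := by
      intro ε hε
      have hw : ∀ j, 0 < Pi.single (M := fun _ => ℝ) i 1 j + ε := fun j => by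
        rcases eq_or_ne j i with rfl | h <;> simp [*]; positivity
      obtain ⟨hQ, h⟩ := sum_mul_deformedLog_div_le hq hq0 H hw
      have h' := sum_mul_rpow_div_rpow hp1 one_ne_zero hw hQ
      simp only [Real.rpow_one, one_mul] at h'
      have h2 := (h'.symm.le.trans (add_le_add_right h 1))
      rw [div_le_iff₀ hQ] at h2
      simpa [mul_add, Finset.sum_add_distrib, ← Finset.sum_mul, hp1, Pi.single_apply,
        mul_comm ε] using h2
    have l1 : Tendsto (fun ε : ℝ => p i + ε) (𝓝[>] 0) (𝓝 (p i + 0)) :=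
      tendsto_nhdsWithin_of_tendsto_nhds (by fun_prop : Continuous _).continuousAt
    have l2 : Tendsto (fun ε : ℝ => (1 + F) * (q i + ε * ∑ j, q j)) (𝓝[>] 0)
        (𝓝 ((1 + F) * (q i + 0 * ∑ j, q j))) :=
      tendsto_nhdsWithin_of_tendsto_nhds (Continuous.continuousAt
        (f := fun ε : ℝ => (1 + F) * (q i + ε * ∑ j, q j)) (by fun_prop))
    simpa using le_of_tendsto_of_tendsto l1 l2
      (by filter_upwards [self_mem_nhdsWithin] with ε hε using key ε hε)
  have ha0 : 0 < α.toReal := ENNReal.toReal_pos h0 htop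
  have hge : gainExponent α = (α.toReal - 1) / α.toReal := if_neg htop
  rw [hge] at H hG ⊢
  set a := α.toReal with ha
  set s := (a - 1) / a with hs
  have hinv : (1 - s) * a = 1 := by rw [hs]; field_simp; ring
  rw [gainFactor_mul_log htop, renyiDiv_eq_log h1 htop, ← ha,
    ENNReal.ofReal_rpow_of_pos hG]
  refine ENNReal.log_le_log ?_
  have hS := renyiSum_nonneg hp hq a
  -- The factor s on both sides lets one bound cover both signs of s. In the limit it compares
  -- S^(1-s) with 1 + sF for S the Rényi sum, and (1 - s) a = 1 isolates S.
  have key : ∀ᶠ ε in 𝓝[>] (0 : ℝ), s ≠ 0 → 0 < ∑ i, q i * ((p i + ε) / (q i + ε)) ^ a ∧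
      s * ((∑ i, p i * (((p i + ε) / (q i + ε)) ^ a) ^ s) /
        (∑ i, q i * ((p i + ε) / (q i + ε)) ^ a) ^ s) ≤ s * (1 + s * F) := by
    filter_upwards [self_mem_nhdsWithin] with ε (hε : 0 < ε) hs0
    have hw : ∀ i, 0 < ((p i + ε) / (q i + ε)) ^ a := fun i =>
      Real.rpow_pos_of_pos (div_pos (add_pos_of_nonneg_of_pos (hp i) hε)
        (add_pos_of_nonneg_of_pos (hq i) hε)) _
    obtain ⟨hQ, h⟩ := sum_mul_deformedLog_div_le hq hq0 H hw
    refine ⟨hQ, ?_⟩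
    rw [← sum_mul_rpow_div_rpow hp1 hs0 hw hQ, mul_add, mul_add, ← mul_assoc, ← mul_assoc]
    gcongr
    exact mul_self_nonneg s
  rcases lt_or_gt_of_ne h1 with h | h
  · have ha1 : a < 1 := by
      simpa using (ENNReal.toReal_lt_toReal htop ENNReal.one_ne_top).2 h
    have hs0 : s < 0 := div_neg_of_neg_of_pos (by linarith) ha0
    refine ennreal_rpow_le_rpow_of_nonpos ?_ (inv_nonpos.2 (by linarith))
    rw [sum_ofReal_rpow_mul_eq hp hq ha0 (Or.inl ha1)]
    refine ENNReal.ofReal_le_ofReal ?_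
    have lim := (tendsto_sum_regularized_rpow hp hq ha0 (Or.inl ha1)).mul
      ((tendsto_sum_regularized hp hq ha0 (Or.inl ha1)).rpow_const (p := -s)
        (Or.inr (by linarith)))
    have hle : 1 + s * F ≤ renyiSum a p q * renyiSum a p q ^ (-s) := by
      refine ge_of_tendsto lim ?_
      filter_upwards [key] with ε hε
      obtain ⟨hQ, h⟩ := hε hs0.ne
      rw [Real.rpow_neg hQ.le, ← div_eq_mul_inv]
      exact (mul_le_mul_left_of_neg hs0).1 h
    have hSpos : 0 < renyiSum a p q := hS.lt_of_ne' fun h' => by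
      rw [h', zero_mul] at hle; linarith
    rw [← Real.rpow_one_add' hS (by linarith), ← sub_eq_add_neg] at hle
    have := Real.rpow_le_rpow hG.le hle ha0.le
    rwa [← Real.rpow_mul hS, hinv, Real.rpow_one] at this
  · have ha1 : 1 < a := by
      simpa using (ENNReal.toReal_lt_toReal ENNReal.one_ne_top htop).2 h
    have hs0 : 0 < s := div_pos (by linarith) ha0
    have hpq := eq_zero_of_sum_mul_deformedLog_le hp hq hq0 hs0.le H
    refine ENNReal.rpow_le_rpow ?_ (inv_nonneg.2 (by linarith))
    rw [sum_ofReal_rpow_mul_eq hp hq ha0 (Or.inr hpq)]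
    refine ENNReal.ofReal_le_ofReal ?_
    rcases hS.eq_or_lt with hS0 | hSpos
    · rw [← hS0]; exact Real.rpow_nonneg hG.le _
    have hle : renyiSum a p q ≤ (1 + s * F) * renyiSum a p q ^ s := by
      refine le_of_tendsto_of_tendsto (tendsto_sum_regularized_rpow hp hq ha0 (Or.inr hpq))
        (((tendsto_sum_regularized hp hq ha0 (Or.inr hpq)).rpow_const
          (Or.inr hs0.le)).const_mul _) ?_
      filter_upwards [key] with ε hε
      obtain ⟨hQ, h⟩ := hε hs0.ne'
      exact (div_le_iff₀ (Real.rpow_pos_of_pos hQ _)).1 (le_of_mul_le_mul_left h hs0)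
    have hle' : renyiSum a p q ^ (1 - s) ≤ 1 + s * F := by
      rw [Real.rpow_sub hSpos, Real.rpow_one]
      exact (div_le_iff₀ (Real.rpow_pos_of_pos hSpos _)).2 hle
    have := Real.rpow_le_rpow (Real.rpow_nonneg hS _) hle' ha0.le
    rwa [← Real.rpow_mul hS, hinv, Real.rpow_one] at this

/-- With weights (p+ε)/(q+ε) the normalisation tends to ∑ pᵢ = 1, so its logarithm disappears in the
limit. -/
theorem renyiDiv_one_le (hp : ∀ i, 0 ≤ p i) (hp1 : ∑ i, p i = 1)
    (hq : ∀ i, 0 ≤ q i) (hq0 : 0 < ∑ i, q i)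
    (H : ∀ w : ι → ℝ, (∀ i, 0 < w i) → ∑ i, q i * w i = 1 →
      ∑ i, p i * deformedLog 0 (w i) ≤ F) :
    renyiDiv 1 p q ≤ F := by
  have hpq := eq_zero_of_sum_mul_deformedLog_le hp hq hq0 le_rfl H
  rw [renyiDiv, if_neg ENNReal.one_ne_top, if_pos rfl, if_pos hpq, EReal.coe_le_coe_iff]
  have hS : renyiSum 1 p q = 1 := by simp [renyiSum, hp1]
  have l1 := tendsto_sum_regularized hp hq one_pos (Or.inr hpq)
  rw [hS] at l1
  have l2 : Tendsto (fun ε => ∑ i, p i * Real.log ((p i + ε) / (q i + ε))) (𝓝[>] 0)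
      (𝓝 (∑ i, p i * Real.log (p i / q i))) := by
    refine tendsto_finsetSum _ fun i _ => ?_
    rcases (hp i).eq_or_lt with h0 | h0
    · simp [← h0]
    · have hqi : q i ≠ 0 := fun h' => h0.ne' (hpq i h')
      have : ContinuousAt (fun ε => p i * Real.log ((p i + ε) / (q i + ε))) 0 := by
        refine continuousAt_const.mul (ContinuousAt.log
          (ContinuousAt.div (by fun_prop) (by fun_prop) (by simpa using hqi)) ?_)
        simp [h0.ne', hqi]
      simpa using this.tendsto.mono_left nhdsWithin_le_nhds
  have l3 := (l1.log one_ne_zero).const_add F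
  rw [Real.log_one, add_zero] at l3
  refine le_of_tendsto_of_tendsto l2 l3 ?_
  filter_upwards [self_mem_nhdsWithin] with ε (hε : 0 < ε)
  have hw : ∀ i, 0 < (p i + ε) / (q i + ε) := fun i =>
    div_pos (add_pos_of_nonneg_of_pos (hp i) hε) (add_pos_of_nonneg_of_pos (hq i) hε)
  obtain ⟨hQ, h⟩ := sum_mul_deformedLog_div_le hq hq0 H hw
  simp_rw [deformedLog_zero, Real.log_div (hw _).ne' hQ.ne', mul_sub, Finset.sum_sub_distrib,
    ← Finset.sum_mul, hp1, one_mul] at h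
  simp_rw [Real.rpow_one]
  linarith

end ClassicalDivergence

/-! ### Measuring in the eigenbasis of the POVM operator -/

section SpectralMeasurement
variable {d : Type*} [Fintype d] [DecidableEq d] {Ω ρ : Matrix d d ℂ}

theorem exists_eq_mul_of_supp_le (h : supp ρ ≤ supp Ω) : ∃ C : Matrix d d ℂ, ρ = Ω * C := by
  have : ∀ k, ∃ v, Ω.mulVec v = ρ.mulVec (Pi.single k 1) := fun k => by
    obtain ⟨v, hv⟩ := h ⟨Pi.single k 1, rfl⟩
    exact ⟨v, hv⟩
  choose v hv using this
  refine ⟨Matrix.of fun i k => v k i, ?_⟩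
  ext i k
  have := congrFun (hv k) i
  rw [Matrix.mulVec_single_one] at this
  exact this.symm

theorem supp_le_of_posDef (hΩ : Ω.PosDef) : supp ρ ≤ supp Ω := by
  have : supp Ω = ⊤ := LinearMap.range_eq_top.2
    (Matrix.mulVec_surjective_iff_isUnit.2 hΩ.isUnit)
  exact this ▸ le_top

theorem spectralProj_mul (hΩ : Ω.IsHermitian) (j : d) :
    spectralProj hΩ j * Ω = hΩ.eigenvalues j • spectralProj hΩ j := by
  refine (congrArg (spectralProj hΩ j * ·) hΩ.spectral_theorem).trans ?_
  rw [spectralProj, ← map_mul, Matrix.diagonal_mul_diagonal, ← Complex.coe_smul, ← map_smul]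
  congr 1
  ext a b
  simp only [Matrix.diagonal_apply, Matrix.smul_apply, Pi.single_apply]
  split_ifs with h h'
  · subst h h'; simp
  all_goals simp

/-- Hence the default values of `0 ^ s` and `Real.log 0` never contribute, and the functional
calculus acts as if on the support. -/
theorem trace_mul_spectralProj_eq_zero (hΩ : Ω.IsHermitian) (h : supp ρ ≤ supp Ω) (j : d)
    (hj : hΩ.eigenvalues j = 0) : (ρ * spectralProj hΩ j).trace.re = 0 := by
  obtain ⟨C, rfl⟩ := exists_eq_mul_of_supp_le h
  rw [mul_assoc, Matrix.trace_mul_comm, mul_assoc, spectralProj_mul, hj]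
  simp

variable {τ : Matrix d d ℂ}

/-- The outcome statistics of the spectral measurement of `Ω`. -/
theorem renyiDiv_spectralProj_le_measuredRenyiDiv (hΩ : Ω.IsHermitian) (α : ℝ≥0∞) :
    renyiDiv α (fun i => (ρ * spectralProj hΩ ((Fintype.equivFin d).symm i)).trace.re)
      (fun i => (τ * spectralProj hΩ ((Fintype.equivFin d).symm i)).trace.re)
      ≤ measuredRenyiDiv α ρ τ := by
  refine le_iSup_of_le (Fintype.card d) (le_iSup₂_of_le
    (fun i => spectralProj hΩ ((Fintype.equivFin d).symm i)) ⟨?_, ?_⟩ le_rfl)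
  · exact fun i => posSemidef_spectralProj hΩ _
  · rw [Equiv.sum_comp, (isPOVM_spectralProj hΩ).2]

theorem sum_trace_mul_spectralProj_mul_eigenvalues (hΩ : Ω.IsHermitian) :
    ∑ j, (τ * spectralProj hΩ j).trace.re * hΩ.eigenvalues j = (τ * Ω).trace.re := by
  rw [← re_trace_mul_sum_smul, sum_eigenvalues_smul_spectralProj]

theorem gainFactor_neg {α : ℝ≥0∞} (h0 : α ≠ 0) (h : α < 1) : gainFactor α < 0 := by
  rw [gainFactor, if_neg h.ne_top]
  have : α.toReal < 1 := by
    simpa using (ENNReal.toReal_lt_toReal h.ne_top ENNReal.one_ne_top).2 h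
  exact div_neg_of_pos_of_neg (ENNReal.toReal_pos h0 h.ne_top) (by linarith)

theorem gainFactor_mul_log_expectedGain_le (hρ : ρ.PosSemidef) (hΩ : Ω.PosSemidef)
    (hτ : τ.PosSemidef) (hτΩ : (τ * Ω).trace.re = 1) {α : ℝ≥0∞} (h0 : α ≠ 0) (h1 : α ≠ 1) :
    (gainFactor α : EReal) * ENNReal.log (expectedGain α ρ Ω) ≤ measuredRenyiDiv α ρ τ := by
  rw [expectedGain]
  split_ifs with h
  · rw [ENNReal.log_top, EReal.coe_mul_top_of_neg (gainFactor_neg h0 h.1)]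
    exact bot_le
  refine le_trans ?_ (renyiDiv_spectralProj_le_measuredRenyiDiv hΩ.1 α)
  rw [re_trace_mul_cfc hΩ.1, ← Equiv.sum_comp (Fintype.equivFin d).symm]
  refine gainFactor_mul_log_le_renyiDiv
    (fun i => trace_mul_re_nonneg hρ (posSemidef_spectralProj _ _))
    (fun i => trace_mul_re_nonneg hτ (posSemidef_spectralProj _ _))
    (w := fun i => hΩ.1.eigenvalues ((Fintype.equivFin d).symm i))
    (fun i => hΩ.eigenvalues_nonneg _) ?_ h0 h1 ?_
  · rw [Equiv.sum_comp (Fintype.equivFin d).symm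
      (fun j => (τ * spectralProj hΩ.1 j).trace.re * hΩ.1.eigenvalues j),
      sum_trace_mul_spectralProj_mul_eigenvalues, hτΩ]
  · intro hα i hi
    exact trace_mul_spectralProj_eq_zero hΩ.1 (by by_contra h'; exact h ⟨hα, h'⟩) _ hi

theorem neg_expectedLogLoss_le (hρ : IsDensity ρ) (hΩ : Ω.PosSemidef)
    (hτ : τ.PosSemidef) (hτΩ : (τ * Ω).trace.re = 1) :
    -expectedLogLoss ρ Ω ≤ measuredRenyiDiv 1 ρ τ := by
  rw [expectedLogLoss]
  split_ifs with h
  swap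
  · simp
  refine le_trans ?_ (renyiDiv_spectralProj_le_measuredRenyiDiv hΩ.1 1)
  rw [re_trace_mul_cfc hΩ.1, ← Equiv.sum_comp (Fintype.equivFin d).symm, ← EReal.coe_neg, neg_neg]
  refine sum_mul_log_le_renyiDiv_one
    (fun i => trace_mul_re_nonneg hρ.1 (posSemidef_spectralProj _ _)) ?_
    (fun i => trace_mul_re_nonneg hτ (posSemidef_spectralProj _ _))
    (w := fun i => hΩ.1.eigenvalues ((Fintype.equivFin d).symm i))
    (fun i => hΩ.eigenvalues_nonneg _) ?_ ?_
  · rw [Equiv.sum_comp (Fintype.equivFin d).symm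
      (fun j => (ρ * spectralProj hΩ.1 j).trace.re),
      sum_re_trace_mul_of_isPOVM (isPOVM_spectralProj _), hρ.2, Complex.one_re]
  · exact fun i hi => trace_mul_spectralProj_eq_zero hΩ.1 h _ hi
  · rw [Equiv.sum_comp (Fintype.equivFin d).symm
      (fun j => (τ * spectralProj hΩ.1 j).trace.re * hΩ.1.eigenvalues j),
      sum_trace_mul_spectralProj_mul_eigenvalues, hτΩ]

/-! ### A priori bounds on the gain -/

/-- Average the affine majorant over the spectral distribution of Ω under ρ, whose mean is at most
1. The eigenvalue 0 is exempt when it carries no mass. -/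
theorem re_trace_mul_cfc_le (hρ : IsDensity ρ) (hΩ : Ω.PosSemidef) (h1 : (ρ * Ω).trace.re ≤ 1)
    {f : ℝ → ℝ} {b c : ℝ} (hc : 0 ≤ c)
    (hf : ∀ t, 0 ≤ t → (t = 0 → ¬ supp ρ ≤ supp Ω) → f t ≤ b + c * (t - 1)) :
    (ρ * cfc f Ω).trace.re ≤ b := by
  rw [re_trace_mul_cfc hΩ.1]
  have hsum : ∑ j, (ρ * spectralProj hΩ.1 j).trace.re = 1 := by
    rw [sum_re_trace_mul_of_isPOVM (isPOVM_spectralProj _), hρ.2, Complex.one_re]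
  calc ∑ j, (ρ * spectralProj hΩ.1 j).trace.re * f (hΩ.1.eigenvalues j)
      ≤ ∑ j, (ρ * spectralProj hΩ.1 j).trace.re * (b + c * (hΩ.1.eigenvalues j - 1)) := by
        refine Finset.sum_le_sum fun j _ => ?_
        have hp := trace_mul_re_nonneg hρ.1 (posSemidef_spectralProj hΩ.1 j)
        by_cases h : hΩ.1.eigenvalues j = 0 ∧ supp ρ ≤ supp Ω
        · rw [trace_mul_spectralProj_eq_zero hΩ.1 h.2 j h.1, zero_mul, zero_mul]
        · exact mul_le_mul_of_nonneg_left
            (hf _ (hΩ.eigenvalues_nonneg j) fun h0 hs => h ⟨h0, hs⟩) hp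
    _ = b + c * ((ρ * Ω).trace.re - 1) := by
        rw [← sum_trace_mul_spectralProj_mul_eigenvalues hΩ.1]
        simp_rw [mul_add, Finset.sum_add_distrib, ← Finset.sum_mul, hsum, mul_left_comm _ c,
          ← Finset.mul_sum, mul_sub, mul_one, Finset.sum_sub_distrib, hsum]
        ring
    _ ≤ b := by nlinarith

theorem one_add_mul_re_trace_mul_cfc_deformedLog (hρ : IsDensity ρ) (hΩ : Ω.IsHermitian) {s : ℝ}
    (hs : s ≠ 0) :
    1 + s * (ρ * cfc (deformedLog s) Ω).trace.re
      = (ρ * cfc (fun t : ℝ => t ^ s) Ω).trace.re := by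
  have hsum : ∑ j, (ρ * spectralProj hΩ j).trace.re = 1 := by
    rw [sum_re_trace_mul_of_isPOVM (isPOVM_spectralProj _), hρ.2, Complex.one_re]
  simp_rw [re_trace_mul_cfc hΩ, ← one_add_mul_deformedLog hs, mul_add, mul_one,
    Finset.sum_add_distrib, hsum, mul_left_comm _ s, ← Finset.mul_sum]

theorem re_trace_mul_cfc_rpow_pos (hρ : IsDensity ρ) (hΩ : Ω.PosDef) (s : ℝ) :
    0 < (ρ * cfc (fun t : ℝ => t ^ s) Ω).trace.re := by
  have hsum : ∑ j, (ρ * spectralProj hΩ.1 j).trace.re = 1 := by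
    rw [sum_re_trace_mul_of_isPOVM (isPOVM_spectralProj _), hρ.2, Complex.one_re]
  rw [re_trace_mul_cfc hΩ.1]
  obtain ⟨j, hj, h⟩ : ∃ j ∈ Finset.univ, 0 < (ρ * spectralProj hΩ.1 j).trace.re := by
    by_contra! h
    have := Finset.sum_nonpos h
    linarith
  exact Finset.sum_pos' (fun j _ => mul_nonneg
    (trace_mul_re_nonneg hρ.1 (posSemidef_spectralProj _ _))
    (Real.rpow_nonneg (hΩ.eigenvalues_pos j).le _))
    ⟨j, hj, mul_pos h (Real.rpow_pos_of_pos (hΩ.eigenvalues_pos j) _)⟩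

end SpectralMeasurement

/-! ### The duality for gain and log-loss -/

section POVM
variable {X B : Type*} [Fintype X] [DecidableEq X] [Fintype B] [DecidableEq B]
  {a : X → Matrix B B ℂ} {E : X → Matrix B B ℂ}

theorem re_trace_mul_cqOp_le_one (ha : IsDensity (cqOp a)) (hE : IsPOVM E) :
    (cqOp a * cqOp E).trace.re ≤ 1 := by
  have hpos : (cqOp fun x => 1 - E x).PosSemidef := posSemidef_cqOp fun x => by
    rw [← hE.2, ← Finset.add_sum_erase _ _ (Finset.mem_univ x), add_sub_cancel_left]
    exact Matrix.posSemidef_sum _ fun y _ => hE.1 y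
  have hadd : cqOp (fun x => 1 - E x) = 1 - cqOp E := by
    rw [eq_sub_iff_add_eq, ← cqOp_add, ← cqOp_one]
    congr 1
    ext1 x
    simp
  have := trace_mul_re_nonneg ha.1 hpos
  rw [hadd, mul_sub, mul_one, Matrix.trace_sub, ha.2, Complex.sub_re, Complex.one_re] at this
  linarith

theorem re_trace_const_mul_cqOp {σ : Matrix B B ℂ} (hσ : IsDensity σ) (hE : IsPOVM E) :
    (((1 : Matrix X X ℂ) ⊗ₖ σ) * cqOp E).trace.re = 1 := by
  rw [cqOp_const, trace_cqOp_mul_cqOp, ← Matrix.trace_sum, ← Finset.mul_sum, hE.2, mul_one, hσ.2,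
    Complex.one_re]

theorem exists_isPOVM_posDef [Nonempty X] :
    ∃ E : X → Matrix B B ℂ, IsPOVM E ∧ (cqOp E).PosDef := by
  have hpos : 0 < (Fintype.card X : ℝ)⁻¹ := by positivity
  have hpd : ((Fintype.card X : ℝ)⁻¹ • (1 : Matrix B B ℂ)).PosDef :=
    Matrix.PosDef.one.smul hpos
  refine ⟨fun _ => (Fintype.card X : ℝ)⁻¹ • 1, ⟨fun _ => hpd.posSemidef, ?_⟩,
    posDef_cqOp fun _ => hpd⟩
  rw [Finset.sum_const, Finset.card_univ, ← Nat.cast_smul_eq_nsmul ℝ, smul_smul,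
    mul_inv_cancel₀ (by positivity), one_smul]

theorem measuredRenyiDiv_le_of_forall [Nonempty X] {σ : Matrix B B ℂ} (hσ : IsDensity σ)
    (ha : IsDensity (cqOp a)) {α : ℝ≥0∞} {D : EReal}
    (h : ∀ (n : ℕ) (M : Fin n → Matrix (X × B) (X × B) ℂ), IsPOVM M →
      (∀ i, 0 ≤ (cqOp a * M i).trace.re) → ∑ i, (cqOp a * M i).trace.re = 1 →
      (∀ i, 0 ≤ (cqOp (fun _ : X => σ) * M i).trace.re) →
      0 < ∑ i, (cqOp (fun _ : X => σ) * M i).trace.re →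
      renyiDiv α (fun i => (cqOp a * M i).trace.re)
        (fun i => (cqOp (fun _ : X => σ) * M i).trace.re) ≤ D) :
    measuredRenyiDiv α (cqOp a) ((1 : Matrix X X ℂ) ⊗ₖ σ) ≤ D := by
  rw [cqOp_const]
  refine iSup_le fun n => iSup₂_le fun M hM => h n M hM
    (fun i => trace_mul_re_nonneg ha.1 (hM.1 i)) ?_
    (fun i => trace_mul_re_nonneg (posSemidef_cqOp fun _ => hσ.1) (hM.1 i)) ?_
  · rw [sum_re_trace_mul_of_isPOVM hM, ha.2, Complex.one_re]
  · rw [sum_re_trace_mul_of_isPOVM hM, trace_cqOp]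
    simp [hσ.2, Fintype.card_pos]

theorem gainExponent_mem {α : ℝ≥0∞} (hα : 1 / 2 ≤ α) :
    -1 ≤ gainExponent α ∧ gainExponent α ≤ 1 := by
  rw [gainExponent]
  split_ifs with h
  · norm_num
  · have : (1 / 2 : ℝ) ≤ α.toReal := by
      simpa using ENNReal.toReal_mono h hα
    rw [le_div_iff₀ (by linarith), div_le_iff₀ (by linarith)]
    constructor <;> linarith

theorem gainExponent_neg {α : ℝ≥0∞} (h0 : α ≠ 0) (h : α < 1) : gainExponent α < 0 := by
  have := gainFactor_neg h0 h
  rw [gainFactor, if_neg h.ne_top] at this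
  rw [gainExponent, if_neg h.ne_top, ← inv_div]
  exact inv_lt_zero.2 this

theorem gainExponent_gainFactor_pos {α : ℝ≥0∞} (h : 1 < α) :
    0 < gainExponent α ∧ 0 < gainFactor α := by
  rw [gainExponent, gainFactor]
  split_ifs with ht
  · simp
  · have : 1 < α.toReal := by
      simpa using (ENNReal.toReal_lt_toReal ENNReal.one_ne_top ht).2 h
    exact ⟨div_pos (by linarith) (by linarith), div_pos (by linarith) (by linarith)⟩

theorem expectedGain_of_posDef {d : Type*} [Fintype d] [DecidableEq d] {ρ Ω : Matrix d d ℂ}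
    (hΩ : Ω.PosDef) (α : ℝ≥0∞) :
    expectedGain α ρ Ω
      = ENNReal.ofReal (ρ * cfc (fun t : ℝ => t ^ gainExponent α) Ω).trace.re :=
  if_neg fun h => h.2 (supp_le_of_posDef hΩ)

/-- Lets the optimum be treated as a positive real. The tangent at 1 bounds it below by 1 if α < 1
and above by 1 if α > 1; the uniform POVM gives the other side. -/
theorem optimalGain_pos_lt_top [Nonempty X] (ha : IsDensity (cqOp a)) {α : ℝ≥0∞}
    (hα : 1 / 2 ≤ α) (h1 : α ≠ 1) :
    0 < optimalGain α (cqOp a) ∧ optimalGain α (cqOp a) < ⊤ := by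
  have h0 : α ≠ 0 := fun h => by simp [h] at hα
  obtain ⟨E₀, hE₀, hE₀'⟩ := exists_isPOVM_posDef (X := X) (B := B)
  have hgain₀ : expectedGain α (cqOp a) (cqOp E₀)
      = ENNReal.ofReal (cqOp a * cfc (fun t : ℝ => t ^ gainExponent α) (cqOp E₀)).trace.re :=
    expectedGain_of_posDef hE₀' α
  obtain ⟨hs, hs'⟩ := gainExponent_mem hα
  rw [optimalGain]
  split_ifs with h
  · have hneg := gainExponent_neg h0 h
    refine ⟨one_pos.trans_le (le_iInf₂ fun E hE => ?_), (iInf₂_le E₀ hE₀).trans_lt ?_⟩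
    · rw [expectedGain]
      split_ifs with hsupp
      · exact le_top
      have hsupp : supp (cqOp a) ≤ supp (cqOp E) := by by_contra h'; exact hsupp ⟨h, h'⟩
      rw [← ENNReal.ofReal_one]
      refine ENNReal.ofReal_le_ofReal ?_
      have hEpsd := posSemidef_cqOp hE.1
      have hle := re_trace_mul_cfc_le ha hEpsd (re_trace_mul_cqOp_le_one ha hE)
        (f := deformedLog (gainExponent α)) (b := 0) (c := 1) zero_le_one
        fun t ht h => by
          rw [zero_add, one_mul]
          exact deformedLog_le_sub_one hs' (ht.lt_of_ne' fun h' => h h' hsupp)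
      rw [← one_add_mul_re_trace_mul_cfc_deformedLog ha hEpsd.1 hneg.ne]
      nlinarith
    · rw [hgain₀]; exact ENNReal.ofReal_lt_top
  · have hpos := (gainExponent_gainFactor_pos (lt_of_le_of_ne (not_lt.1 h) h1.symm)).1
    refine ⟨lt_of_lt_of_le ?_ (le_iSup₂ E₀ hE₀),
      (iSup₂_le fun E hE => ?_).trans_lt ENNReal.one_lt_top⟩
    · rw [hgain₀, ENNReal.ofReal_pos]
      exact re_trace_mul_cfc_rpow_pos ha hE₀' _
    · rw [expectedGain, if_neg fun h' => h h'.1, ← ENNReal.ofReal_one]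
      refine ENNReal.ofReal_le_ofReal (re_trace_mul_cfc_le ha (posSemidef_cqOp hE.1)
        (re_trace_mul_cqOp_le_one ha hE) hpos.le fun t ht _ => ?_)
      have := rpow_one_add_le_one_add_mul_self (s := t - 1) (by linarith) hpos.le hs'
      rwa [add_sub_cancel] at this

/-- Writing D = log y and c log G = log G^c moves the claim to `ℝ≥0∞`, away from infinities in
`EReal`. -/
theorem coe_mul_log_iSup_le {ι : Sort*} {c : ℝ} (hc : 0 < c) {G : ι → ℝ≥0∞} {D : EReal}
    (h : ∀ i, (c : EReal) * ENNReal.log (G i) ≤ D) :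
    (c : EReal) * ENNReal.log (⨆ i, G i) ≤ D := by
  obtain ⟨y, rfl⟩ := ENNReal.log_surjective D
  simp only [← ENNReal.log_rpow, ENNReal.log_le_log_iff, ← ENNReal.le_rpow_inv_iff hc] at h ⊢
  exact iSup_le h

theorem coe_mul_log_iInf_le {ι : Sort*} {c : ℝ} (hc : c < 0) {G : ι → ℝ≥0∞} {D : EReal}
    (h : ∀ i, (c : EReal) * ENNReal.log (G i) ≤ D) :
    (c : EReal) * ENNReal.log (⨅ i, G i) ≤ D := by
  obtain ⟨y, rfl⟩ := ENNReal.log_surjective D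
  have hc' : 0 < -c := neg_pos.2 hc
  rw [← neg_neg c] at h ⊢
  simp only [← ENNReal.log_rpow, ENNReal.log_le_log_iff, ENNReal.rpow_neg _ (-c),
    ENNReal.inv_le_iff_inv_le (b := y), ← ENNReal.rpow_inv_le_iff hc'] at h ⊢
  exact le_iInf h

theorem gainFactor_mul_log_optimalGain [Nonempty X] [Nonempty B] (ha : IsDensity (cqOp a))
    {α : ℝ≥0∞} (hα : 1 / 2 ≤ α) (h1 : α ≠ 1) :
    (gainFactor α : EReal) * ENNReal.log (optimalGain α (cqOp a))
      = -measuredCondEntropy α (cqOp a) := by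
  have h0 : α ≠ 0 := fun h => by simp [h] at hα
  rw [measuredCondEntropy, neg_neg]
  apply le_antisymm
  · refine le_iInf₂ fun σ hσ => ?_
    have key : ∀ E : X → Matrix B B ℂ, IsPOVM E → (gainFactor α : EReal) *
        ENNReal.log (expectedGain α (cqOp a) (cqOp E))
        ≤ measuredRenyiDiv α (cqOp a) ((1 : Matrix X X ℂ) ⊗ₖ σ) := fun E hE =>
      gainFactor_mul_log_expectedGain_le ha.1 (posSemidef_cqOp hE.1)
        (cqOp_const (X := X) σ ▸ posSemidef_cqOp fun _ => hσ.1)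
        (re_trace_const_mul_cqOp hσ hE) h0 h1
    rw [optimalGain]
    split_ifs with h
    · rw [iInf_subtype']
      exact coe_mul_log_iInf_le (gainFactor_neg h0 h) fun E => key E.1 E.2
    · rw [iSup_subtype']
      exact coe_mul_log_iSup_le
        (gainExponent_gainFactor_pos (lt_of_le_of_ne (not_lt.1 h) h1.symm)).2
        fun E => key E.1 E.2
  obtain ⟨hpos, hfin⟩ := optimalGain_pos_lt_top ha hα h1
  obtain ⟨hs, hs'⟩ := gainExponent_mem hα
  set s := gainExponent α with hsdef
  set G := (optimalGain α (cqOp a)).toReal with hG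
  have hGpos : 0 < G := ENNReal.toReal_pos hpos.ne' hfin.ne
  have hGeq : optimalGain α (cqOp a) = ENNReal.ofReal G := (ENNReal.ofReal_toReal hfin.ne).symm
  have hs0 : s ≠ 0 := by
    rcases lt_or_gt_of_ne h1 with h | h
    · exact (gainExponent_neg h0 h).ne
    · exact (gainExponent_gainFactor_pos h).1.ne'
  -- F is the optimal gain on the ln_s scale, so that 1 + sF is the gain itself.
  have hF : 1 + s * ((G - 1) / s) = G := by field_simp; ring
  obtain ⟨σ, hσ, H⟩ := exists_isDensity_forall_sum_mul_deformedLog_le ha hs hs'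
    (F := (G - 1) / s) (hGpos.le.trans_eq hF.symm) fun E hE hEpd => by
      have e := one_add_mul_re_trace_mul_cfc_deformedLog ha hEpd.1 hs0
      have hgain := expectedGain_of_posDef (ρ := cqOp a) hEpd α
      have hg0 := (re_trace_mul_cfc_rpow_pos ha hEpd s).le
      rw [← hsdef] at hgain
      set g := (cqOp a * cfc (fun t : ℝ => t ^ s) (cqOp E)).trace.re
      rcases lt_or_gt_of_ne h1 with h | h
      · have hneg : s < 0 := gainExponent_neg h0 h
        have hle : optimalGain α (cqOp a) ≤ ENNReal.ofReal g := by
          rw [← hgain, optimalGain, if_pos h]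
          exact iInf₂_le E hE
        rw [hGeq, ENNReal.ofReal_le_ofReal_iff hg0] at hle
        rw [le_div_iff_of_neg hneg]
        linarith
      · have hposs : 0 < s := (gainExponent_gainFactor_pos h).1
        have hle : ENNReal.ofReal g ≤ optimalGain α (cqOp a) := by
          rw [← hgain, optimalGain, if_neg h.not_gt]
          exact le_iSup₂ (f := fun (E : X → Matrix B B ℂ) (_ : IsPOVM E) =>
            expectedGain α (cqOp a) (cqOp E)) E hE
        rw [hGeq, ENNReal.ofReal_le_ofReal_iff hGpos.le] at hle
        rw [le_div_iff₀ hposs]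
        linarith
  refine iInf₂_le_of_le σ hσ (measuredRenyiDiv_le_of_forall hσ ha
    fun n M hM hp hp1 hq hq0 => ?_)
  rw [hGeq]
  -- For normalised weights the correction (1 + sF)(∑ qᵢ wᵢ - 1) vanishes.
  have := renyiDiv_le_gainFactor_mul_log (F := (G - 1) / s) hp hp1 hq hq0 h0 h1
    (by rw [← hsdef, hF]; exact hGpos) fun w hw hqw => by
      simpa [hqw] using H n M hM w hw
  rwa [← hsdef, hF] at this

theorem neg_minLogLoss [Nonempty X] [Nonempty B] (ha : IsDensity (cqOp a)) :
    -minLogLoss (cqOp a) = -measuredCondEntropy 1 (cqOp a) := by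
  rw [measuredCondEntropy, neg_neg]
  apply le_antisymm
  · refine le_iInf₂ fun σ hσ => EReal.neg_le.1 (le_iInf₂ fun E hE => EReal.neg_le.1 ?_)
    exact neg_expectedLogLoss_le ha (posSemidef_cqOp hE.1)
      (cqOp_const (X := X) σ ▸ posSemidef_cqOp fun _ => hσ.1) (re_trace_const_mul_cqOp hσ hE)
  -- Together with a positive definite POVM, this makes the minimal loss a real number, so F = -L is
  -- available at s = 0.
  have hnonneg : 0 ≤ minLogLoss (cqOp a) := by
    refine le_iInf₂ fun E hE => ?_
    rw [expectedLogLoss]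
    split_ifs with hsupp
    · rw [EReal.coe_nonneg, Left.nonneg_neg_iff]
      exact re_trace_mul_cfc_le ha (posSemidef_cqOp hE.1) (re_trace_mul_cqOp_le_one ha hE)
        zero_le_one fun t ht h => by
          rw [zero_add, one_mul]
          exact Real.log_le_sub_one_of_pos (ht.lt_of_ne' fun h' => h h' hsupp)
    · exact le_top
  have hle : ∀ E : X → Matrix B B ℂ, IsPOVM E → (cqOp E).PosDef → minLogLoss (cqOp a)
      ≤ ((-(cqOp a * cfc Real.log (cqOp E)).trace.re : ℝ) : EReal) := fun E hE hEpd =>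
    iInf₂_le_of_le E hE (by rw [expectedLogLoss, if_pos (supp_le_of_posDef hEpd)])
  obtain ⟨E₀, hE₀, hE₀'⟩ := exists_isPOVM_posDef (X := X) (B := B)
  obtain ⟨L, hL⟩ : ∃ L : ℝ, minLogLoss (cqOp a) = L :=
    ⟨_, (EReal.coe_toReal ((hle E₀ hE₀ hE₀').trans_lt (EReal.coe_lt_top _)).ne
      (EReal.bot_lt_zero.trans_le hnonneg).ne').symm⟩
  rw [hL] at hle ⊢
  obtain ⟨σ, hσ, H⟩ := exists_isDensity_forall_sum_mul_deformedLog_le ha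
    (s := 0) (F := -L) (by norm_num) zero_le_one (by norm_num) fun E hE hEpd => by
      have := EReal.coe_le_coe_iff.1 (hle E hE hEpd)
      rw [show deformedLog 0 = Real.log from funext deformedLog_zero]
      linarith
  refine iInf₂_le_of_le σ hσ (measuredRenyiDiv_le_of_forall hσ ha
    fun n M hM hp hp1 hq hq0 => ?_)
  rw [← EReal.coe_neg]
  exact renyiDiv_one_le hp hp1 hq hq0 fun w hw hqw => by simpa [hqw] using H n M hM w hw

end POVM

end AlphaGain

theorem mainTheorem1 {X B : Type*} [Fintype X] [DecidableEq X] [Fintype B] [DecidableEq B]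
    (p : X → ℝ) (hp : AlphaGain.IsProb p)
    (ρ : X → Matrix B B ℂ) (hρ : ∀ x, AlphaGain.IsDensity (ρ x))
    (α : ℝ≥0∞) (hα : 1 / 2 ≤ α) :
    (α ≠ 1 →
      (AlphaGain.gainFactor α : EReal) *
          ENNReal.log (AlphaGain.optimalGain α (AlphaGain.cqState p ρ)) =
        -AlphaGain.measuredCondEntropy α (AlphaGain.cqState p ρ)) ∧
    (α = 1 →
      -AlphaGain.minLogLoss (AlphaGain.cqState p ρ) =
        -AlphaGain.measuredCondEntropy 1 (AlphaGain.cqState p ρ)) := by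
  have hX : Nonempty X := by
    by_contra h
    have := not_nonempty_iff.1 h
    simpa using hp.2
  have hB : Nonempty B := by
    by_contra h
    have := not_nonempty_iff.1 h
    simpa [Matrix.trace] using (hρ hX.some).2
  have ha := AlphaGain.isDensity_cqState hp hρ
  exact ⟨AlphaGain.gainFactor_mul_log_optimalGain ha hα, fun _ => AlphaGain.neg_minLogLoss ha⟩
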